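/- Let $\mathbb S=\{y_0<y_1<\dots<y_N\}\subset\mathbb R$ be finite, let $G=(G(x,z))_{x,z\in\mathbb S}$ be a transition rate matrix ($G(x,z)\ge 0$ for $z\ne x$ and $G(x,x)=-\sum_{z\neq x}G(x,z)$), and let $Y$ be a continuous-time Markov chain on $\mathbb S$ with right-continuous paths and transition rate matrix $G$, with law $\mathbb P_x$ when started from $Y_0=x$. Fix $a>0$, $q\in\mathbb C$ with $\Re q>0$, and $f:\mathbb S\times\mathbb S\to\mathbb C$. For $S\subseteq\mathbb R$ let $T_S=\inf\{t>0: Y_t\notin S\}$ and, for $k,g:\mathbb S\to\mathbb C$, $$P_S(k,x;g)=\mathbb E_x\Big[e^{-\int_0^{T_S}k(Y_s)\,ds}\,\mathbf 1_{\{T_S<\infty\}}\,g(Y_{T_S})\Big];$$ $P_S(q,x;g)$ denotes the case of the constant function $k\equiv q$. For $x\le y$ in $\mathbb S$, conditioning on $Y_0=x$, $\overline Y_0=y$ means that $Y$ starts from $x$ and that $\overline Y_t=\max\{y,\sup_{0\le u\le t}Y_u\}$. Put $\overline Y_{s,t}=\sup_{s\le u\le t}Y_u$. The drawdown times with recovery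 are $\tau_{a,0}=0$ and $$\tau_{a,n}=\inf\{t>\tau_{a,n-1}:\ \overline Y_t-Y_t\ge a,\ \overline Y_{\tau_{a,n-1},t}\ge\overline Y_{\tau_{a,n-1}}\},\qquad n\ge1,$$ that is, after $\tau_{a,n-1}$ the chain must first get back to the running maximum it had at time $\tau_{a,n-1}$; here $\inf\emptyset=\infty$, and $\tau_{a,n}=\infty$ if $\tau_{a,n-1}=\infty$. For $n\ge0$ let $$J_n(q,x,y)=\mathbb E\big[e^{-q\tau_{a,n}}f(Y_{\tau_{a,n}},\overline Y_{\tau_{a,n}})\,\big|\,Y_0=x,\ \overline Y_0=y\big],$$ where the integrand is $0$ on $\{\tau_{a,n}=\infty\}$. Then the integrands of $P_S(q,x;g)$ (for all $S$, $g$, $x$) and of $J_n(q,x,y)$ (for all $n\ge 0$, $x\le y$) are integrable, and for all $n\ge1$ and all $x,y\in\mathbb S$ with $x\le y$, $$J_n(q,x,y)=\sum_{z\in\mathbb S,\,z\ge y}P_{(-\infty,y)}\big(q,x;\mathbf 1_{\{\cdot=z\}}\big)\,J_n(q,z,z),$$ $$J_n(q,y,y)=P_{(y-a,y]}\big(q,y;J_{n-1}(q,\cdot,y)\mathbf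 1_{\{\cdot\le y-a\}}\big)+\sum_{z\in\mathbb S,\,z>y}P_{(y-a,y]}\big(q,y;\mathbf 1_{\{\cdot=z\}}\big)\,J_n(q,z,z),$$ with the initial condition $J_0(q,x,y)=f(x,y)$ for $x\le y$. -/

import Mathlib

open MeasureTheory
open scoped NNReal ENNReal

namespace CTMCDrawdown

noncomputable section

/-- `G` is a transition rate matrix: the off-diagonal entries are nonnegative and
`G x x = - ∑_{z ≠ x} G x z`. -/
structure IsRateMatrix {N : ℕ} (G : Matrix (Fin (N + 1)) (Fin (N + 1)) ℝ) : Prop where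
  nonneg : ∀ x z, z ≠ x → 0 ≤ G x z
  diag : ∀ x, G x x = -∑ z ∈ Finset.univ.filter (fun z => z ≠ x), G x z

/-- `(Y_t)_{t ≥ 0}` under the family `(P x)_x` of probability measures is a continuous-time Markov
chain with transition rate matrix `G`: its paths are right-continuous (the finite state set carries
the discrete topology), and under `P x` it starts in `x` and has the finite-dimensional
distributions `P x (Y_{t_0} = z_0, …, Y_{t_n} = z_n) = 1_{z_0 = x} ∏_i e^{(t_{i+1} - t_i) G}(z_i, z_{i+1})`
for `0 = t_0 ≤ t_1 ≤ … ≤ t_n`. A state is named by its index. -/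
structure IsCTMC {N : ℕ} (G : Matrix (Fin (N + 1)) (Fin (N + 1)) ℝ)
    {Ω : Type*} [MeasurableSpace Ω] (P : Fin (N + 1) → Measure Ω)
    (Y : ℝ≥0 → Ω → Fin (N + 1)) : Prop where
  prob : ∀ x, IsProbabilityMeasure (P x)
  meas : ∀ t, Measurable (Y t)
  right_cont : ∀ (ω : Ω) (t : ℝ≥0), ContinuousWithinAt (fun s => Y s ω) (Set.Ici t) t
  fdd : ∀ (x : Fin (N + 1)) (n : ℕ) (t : ℕ → ℝ≥0) (z : ℕ → Fin (N + 1)),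
    t 0 = 0 → Monotone t →
    (P x).real {ω | ∀ i ≤ n, Y (t i) ω = z i} =
      (if z 0 = x then 1 else 0) *
        ∏ i ∈ Finset.range n,
          NormedSpace.exp (((t (i + 1) : ℝ) - (t i : ℝ)) • G) (z i) (z (i + 1))

/-- The first passage time `T_S = inf {t > 0 : w_t ∉ S}` of a path `w`, with `inf ∅ = ∞`;
`grid i` is the real number that the state with index `i` stands for. -/
def firstPassage {N : ℕ} (grid : Fin (N + 1) → ℝ) (S : Set ℝ) (w : ℝ≥0 → Fin (N + 1)) : ℝ≥0∞ :=
  ⨅ (t : ℝ≥0) (_ : 0 < t ∧ grid (w t) ∉ S), (t : ℝ≥0∞)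

/-- `e^{-∫_0^{T_S} k(w_s) ds} 1_{T_S < ∞} g(w_{T_S})` for a path `w`. -/
def passagePayoff {N : ℕ} (grid : Fin (N + 1) → ℝ) (S : Set ℝ) (k g : Fin (N + 1) → ℂ)
    (w : ℝ≥0 → Fin (N + 1)) : ℂ :=
  if firstPassage grid S w < ⊤ then
    Complex.exp (-∫ s in (0 : ℝ)..(firstPassage grid S w).toReal, k (w s.toNNReal)) *
      g (w (firstPassage grid S w).toNNReal)
  else 0

/-- `P_S(k, x; g) = E[e^{-∫_0^{T_S} k(Y_s) ds} 1_{T_S < ∞} g(Y_{T_S}) | Y_0 = x]`. -/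
def passage {N : ℕ} (grid : Fin (N + 1) → ℝ) {Ω : Type*} [MeasurableSpace Ω]
    (P : Fin (N + 1) → Measure Ω) (Y : ℝ≥0 → Ω → Fin (N + 1))
    (S : Set ℝ) (k : Fin (N + 1) → ℂ) (x : Fin (N + 1)) (g : Fin (N + 1) → ℂ) : ℂ :=
  ∫ ω, passagePayoff grid S k g (fun t => Y t ω) ∂(P x)

/-- The maximum `sup_{s ≤ u ≤ t} w_u` over a time window (as a state; the set of indices is a
finite linear order, hence complete). -/
def windowMax {N : ℕ} (w : ℝ≥0 → Fin (N + 1)) (s t : ℝ≥0) : Fin (N + 1) :=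
  ⨆ u ∈ Set.Icc s t, w u

/-- The running maximum at time `t`, started at time `0` from the historical maximum `y`. -/
def runMax {N : ℕ} (y : Fin (N + 1)) (w : ℝ≥0 → Fin (N + 1)) (t : ℝ≥0) : Fin (N + 1) :=
  max y (windowMax w 0 t)

/-- The `n`-th drawdown time with recovery `τ_{a,n}` of a path `w` with historical maximum `y`:
`τ_{a,0} = 0`, and `τ_{a,n+1}` is the infimum of the times `t > τ_{a,n}` at which the drawdown from
the running maximum is at least `a` and by which the path has, since `τ_{a,n}`, got back to the
running maximum of time `τ_{a,n}`. Here `inf ∅ = ∞`, and `τ_{a,n+1} = ∞` if `τ_{a,n} = ∞`. -/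
def drawdownTime {N : ℕ} (grid : Fin (N + 1) → ℝ) (a : ℝ) (y : Fin (N + 1))
    (w : ℝ≥0 → Fin (N + 1)) : ℕ → ℝ≥0∞
  | 0 => 0
  | n + 1 =>
    ⨅ (t : ℝ≥0) (_ : drawdownTime grid a y w n < (t : ℝ≥0∞) ∧
        a ≤ grid (runMax y w t) - grid (w t) ∧
        runMax y w (drawdownTime grid a y w n).toNNReal ≤
          windowMax w (drawdownTime grid a y w n).toNNReal t), (t : ℝ≥0∞)

/-- `e^{-q τ_{a,n}} f(w_{τ_{a,n}}, w̄_{τ_{a,n}})` for a path `w` with historical maximum `y`,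
read as `0` if `τ_{a,n} = ∞`. -/
def drawdownPayoff {N : ℕ} (grid : Fin (N + 1) → ℝ) (a : ℝ)
    (f : Fin (N + 1) → Fin (N + 1) → ℂ) (n : ℕ) (q : ℂ) (y : Fin (N + 1))
    (w : ℝ≥0 → Fin (N + 1)) : ℂ :=
  if drawdownTime grid a y w n < ⊤ then
    Complex.exp (-(q * ((drawdownTime grid a y w n).toReal : ℂ))) *
      f (w (drawdownTime grid a y w n).toNNReal)
        (runMax y w (drawdownTime grid a y w n).toNNReal)
  else 0

/-- `J_n(q, x, y) = E[e^{-q τ_{a,n}} f(Y_{τ_{a,n}}, Ȳ_{τ_{a,n}}) | Y_0 = x, Ȳ_0 = y]`. -/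
def J {N : ℕ} (grid : Fin (N + 1) → ℝ) {Ω : Type*} [MeasurableSpace Ω]
    (P : Fin (N + 1) → Measure Ω) (Y : ℝ≥0 → Ω → Fin (N + 1)) (a : ℝ)
    (f : Fin (N + 1) → Fin (N + 1) → ℂ) (n : ℕ) (q : ℂ) (x y : Fin (N + 1)) : ℂ :=
  ∫ ω, drawdownPayoff grid a f n q y (fun t => Y t ω) ∂(P x)

end

end CTMCDrawdown

/-! Both equations are the strong Markov property at a first passage time `T = T_S`, with `S = (-∞,
y)` for a start in `x ≤ y` and `S = (y - a, y]` for a start in `y`. Before `T` no drawdown with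
recovery can be completed: in the first case the level `y` has not been regained, in the second the
running maximum is still `y` and the drawdown is below `a`. At `T` the problem starts afresh. If the
chain has reached a state `z ≥ y`, the drawdown times are `T` plus those of the path after `T` with
historical maximum `z`. If it has left `(y - a, y]` downwards, then `T` is itself `τ_{a,1}`, and the
remaining times are those of the path after `T` with historical maximum `y` and index lowered by
one. This gives the path identities `drawdownPayoff_eq_of_Iio` and `drawdownPayoff_eq_of_Ioc`;
splitting by the state at `T` turns them into sums of products of expectations
(`IsChainLaw.integral_firstPassage`).

The strong Markov property is derived from the finite-dimensional distributions on the space of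
right-continuous paths. Their product form splits at a fixed time, which gives independence of past
and future on cylinders, and then on all events by a π-system argument. An optional time is
approximated from above by times in `(m + 1)⁻¹ ℕ`. In a finite state space right-continuity means
being constant for a short while, so that the approximating events are eventually equal to the
limiting one, path by path. -/

namespace CTMCDrawdown

open Filter Topology Set

/-! ### Right-continuous step functions and discretisation of time -/

/-- A function of time that is locally constant to the right of every time. -/
def IsRightStep {β : Type*} (w : ℝ≥0 → β) : Prop := ∀ t, ∀ᶠ s in 𝓝[≥] t, w s = w t

theorem IsRightStep.exists_Ico {β : Type*} {w : ℝ≥0 → β} (hw : IsRightStep w) {t c : ℝ≥0}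
    (htc : t < c) : ∃ u, t < u ∧ u ≤ c ∧ ∀ s, t ≤ s → s < u → w s = w t := by
  obtain ⟨u, hu, h⟩ := (mem_nhdsGE_iff_exists_mem_Ioc_Ico_subset htc).1 (hw t)
  exact ⟨u, hu.1, hu.2, fun s h1 h2 => h ⟨h1, h2⟩⟩

theorem isRightStep_of_exists {β : Type*} {w : ℝ≥0 → β}
    (h : ∀ t, ∃ u, t < u ∧ ∀ s, t ≤ s → s < u → w s = w t) : IsRightStep w := by
  intro t
  obtain ⟨u, hu, h⟩ := h t
  filter_upwards [Ico_mem_nhdsGE hu] with s hs using h s hs.1 hs.2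

theorem isRightStep_of_continuousWithinAt {N : ℕ} {w : ℝ≥0 → Fin (N + 1)}
    (h : ∀ t, ContinuousWithinAt w (Ici t) t) : IsRightStep w := by
  intro t
  have := h t
  rw [ContinuousWithinAt, nhds_discrete, tendsto_pure] at this
  exact this

/-- The least point of `(m + 1)⁻¹ ℕ` that is greater than `T`. -/
noncomputable def gridCeil (m : ℕ) (T : ℝ≥0) : ℝ≥0 := (⌊((m : ℝ≥0) + 1) * T⌋₊ + 1) / (m + 1)

theorem lt_gridCeil (m : ℕ) (T : ℝ≥0) : T < gridCeil m T := by
  unfold gridCeil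
  rw [lt_div_iff₀ (by positivity), mul_comm]
  exact Nat.lt_floor_add_one _

theorem gridCeil_le (m : ℕ) (T : ℝ≥0) : gridCeil m T ≤ T + 1 / (m + 1) := by
  unfold gridCeil
  rw [add_div]
  gcongr
  rw [div_le_iff₀ (by positivity), mul_comm]
  exact Nat.floor_le zero_le

theorem tendsto_gridCeil (T : ℝ≥0) : Tendsto (fun m => gridCeil m T) atTop (𝓝[≥] T) := by
  refine tendsto_nhdsWithin_iff.2 ⟨?_, Eventually.of_forall fun m => (lt_gridCeil m T).le⟩
  refine tendsto_of_tendsto_of_tendsto_of_le_of_le tendsto_const_nhds ?_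
    (fun m => (lt_gridCeil m T).le) (fun m => gridCeil_le m T)
  have : Tendsto (fun m : ℕ => (1 : ℝ≥0) / (m + 1)) atTop (𝓝 0) :=
    tendsto_one_div_add_atTop_nhds_zero_nat
  simpa using tendsto_const_nhds.add this

/-- The cells are closed on the left and open on the right, so membership of `T` is expressed by
events `T < s` alone, which is what an optional time allows. -/
theorem gridCeil_eq_iff (m k : ℕ) (T : ℝ≥0) :
    gridCeil m T = ((k : ℝ≥0) + 1) / (m + 1) ↔
      (k : ℝ≥0) / (m + 1) ≤ T ∧ T < ((k : ℝ≥0) + 1) / (m + 1) := by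
  have hm : (0 : ℝ≥0) < m + 1 := by positivity
  unfold gridCeil
  rw [div_left_inj' hm.ne', add_left_inj, Nat.cast_inj, Nat.floor_eq_iff zero_le,
    div_le_iff₀ hm, lt_div_iff₀ hm, mul_comm]

/-- Evaluating a measurable right-step process at a measurable random time. -/
theorem IsRightStep.measurable_eval {α β : Type*} [MeasurableSpace α] [MeasurableSpace β]
    [Countable β] [MeasurableSingletonClass β] {X : ℝ≥0 → α → β} (hX : ∀ t, Measurable (X t))
    (hr : ∀ ω, IsRightStep fun t => X t ω) {τ : α → ℝ≥0} (hτ : Measurable τ) :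
    Measurable fun ω => X (τ ω) ω := by
  have aux : ∀ (φ : ℕ → ℝ≥0) (g : α → ℕ), Measurable g → Measurable fun ω => X (φ (g ω)) ω := by
    intro φ g hg
    have h1 : Measurable fun p : ℕ × α => X (φ p.1) p.2 :=
      measurable_from_prod_countable_right fun k => hX (φ k)
    have h2 : Measurable fun ω => (g ω, ω) := hg.prodMk measurable_id
    exact h1.comp h2
  have key : ∀ m : ℕ, Measurable fun ω => X (gridCeil m (τ ω)) ω := fun m =>
    aux (fun k => ((k : ℝ≥0) + 1) / (m + 1)) (fun ω => ⌊((m : ℝ≥0) + 1) * τ ω⌋₊)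
      (Nat.measurable_floor.comp (hτ.const_mul _))
  refine measurable_to_countable' fun z => ?_
  have : (fun ω => X (τ ω) ω) ⁻¹' {z} =
      ⋃ M : ℕ, ⋂ m ≥ M, (fun ω => X (gridCeil m (τ ω)) ω) ⁻¹' {z} := by
    ext ω
    -- The discretised values are eventually equal to the value at `τ ω`, since the path is constant
    -- just after that time.
    have h := (tendsto_gridCeil (τ ω)).eventually (hr ω (τ ω))
    simp only [mem_preimage, mem_singleton_iff, mem_iUnion, mem_iInter]
    rw [← eventually_atTop]
    constructor
    · rintro rfl
      exact h
    · intro h'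
      obtain ⟨m, h1, h2⟩ := (h.and h').exists
      exact h1.symm.trans h2
  rw [this]
  exact .iUnion fun M => .iInter fun m => .iInter fun _ => key m (measurableSet_singleton z)

/-! ### Path space and its cylinders -/

/-- The space of right-continuous paths with the σ-algebra generated by the coordinates. -/
abbrev RCPath (N : ℕ) : Type := {w : ℝ≥0 → Fin (N + 1) // IsRightStep w}

variable {N : ℕ}

theorem RCPath.measurable_coord (t : ℝ≥0) : Measurable fun w : RCPath N => w.1 t :=
  (measurable_pi_apply t).comp measurable_subtype_coe

theorem RCPath.measurable_of_coord {α : Type*} [MeasurableSpace α] {F : α → RCPath N}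
    (h : ∀ t, Measurable fun a => (F a).1 t) : Measurable F :=
  Measurable.subtype_mk (f := fun a => (F a).1) (measurable_pi_iff.2 h)

/-- The path after time `T`. -/
def RCPath.shift (T : ℝ≥0) (w : RCPath N) : RCPath N :=
  ⟨fun s => w.1 (T + s), isRightStep_of_exists fun t => by
    obtain ⟨u, h1, -, h2⟩ := w.2.exists_Ico (lt_add_one (T + t))
    have hT : T ≤ u := (le_self_add.trans h1.le)
    refine ⟨u - T, lt_tsub_iff_left.2 h1, fun s hs hs' => h2 _ (by gcongr) ?_⟩
    exact lt_tsub_iff_left.1 hs'⟩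

/-- The path frozen at time `T`. -/
def RCPath.freeze (T : ℝ≥0) (w : RCPath N) : RCPath N :=
  ⟨fun s => w.1 (min s T), isRightStep_of_exists fun t => by
    rcases lt_or_ge t T with h | h
    · obtain ⟨u, h1, h3, h2⟩ := w.2.exists_Ico h
      refine ⟨u, h1, fun s hs hs' => ?_⟩
      simp only [min_eq_left (hs'.le.trans h3), min_eq_left h.le, h2 s hs hs']
    · refine ⟨t + 1, lt_add_one t, fun s hs _ => ?_⟩
      simp only [min_eq_right h, min_eq_right (h.trans hs)]⟩

@[simp] theorem RCPath.shift_apply (T : ℝ≥0) (w : RCPath N) (s : ℝ≥0) :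
    (w.shift T).1 s = w.1 (T + s) := rfl

@[simp] theorem RCPath.freeze_apply (T : ℝ≥0) (w : RCPath N) (s : ℝ≥0) :
    (w.freeze T).1 s = w.1 (min s T) := rfl

theorem RCPath.measurable_shift (T : ℝ≥0) : Measurable (RCPath.shift (N := N) T) :=
  RCPath.measurable_of_coord fun s => RCPath.measurable_coord (T + s)

theorem RCPath.measurable_freeze (T : ℝ≥0) : Measurable (RCPath.freeze (N := N) T) :=
  RCPath.measurable_of_coord fun s => RCPath.measurable_coord (min s T)

theorem RCPath.measurable_eval {τ : RCPath N → ℝ≥0} (hτ : Measurable τ) :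
    Measurable fun w : RCPath N => w.1 (τ w) :=
  IsRightStep.measurable_eval (X := fun t (w : RCPath N) => w.1 t)
    RCPath.measurable_coord (fun w => w.2) hτ

theorem RCPath.measurable_shift_random {τ : RCPath N → ℝ≥0} (hτ : Measurable τ) :
    Measurable fun w : RCPath N => w.shift (τ w) :=
  RCPath.measurable_of_coord fun s => RCPath.measurable_eval (hτ.add_const s)

/-- The paths with prescribed values at finitely many times. -/
def cyl (I : Finset ℝ≥0) (ζ : ℝ≥0 → Fin (N + 1)) : Set (RCPath N) := {w | ∀ s ∈ I, w.1 s = ζ s}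

/-- The finite-dimensional cylinders. -/
def cylinders (N : ℕ) : Set (Set (RCPath N)) := {C | ∃ I ζ, C = cyl I ζ}

theorem measurableSet_cyl (I : Finset ℝ≥0) (ζ : ℝ≥0 → Fin (N + 1)) : MeasurableSet (cyl I ζ) := by
  have : cyl I ζ = ⋂ s ∈ I, (fun w : RCPath N => w.1 s) ⁻¹' {ζ s} := by
    ext w; simp [cyl]
  rw [this]
  exact Finset.measurableSet_biInter I fun s _ =>
    RCPath.measurable_coord s (measurableSet_singleton _)

theorem isPiSystem_cylinders : IsPiSystem (cylinders N) := by
  classical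
  rintro _ ⟨I, ζ, rfl⟩ _ ⟨J, ξ, rfl⟩ ⟨w₀, h1, h2⟩
  -- A path in the intersection supplies values compatible with both prescriptions.
  refine ⟨I ∪ J, w₀.1, ?_⟩
  ext w
  simp only [cyl, mem_inter_iff, mem_ofPred_eq, Finset.mem_union] at h1 h2 ⊢
  constructor
  · rintro ⟨h, h'⟩ s (hs | hs)
    · rw [h s hs, h1 s hs]
    · rw [h' s hs, h2 s hs]
  · intro h
    exact ⟨fun s hs => by rw [h s (.inl hs), h1 s hs], fun s hs => by rw [h s (.inr hs), h2 s hs]⟩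

theorem generateFrom_cylinders :
    MeasurableSpace.generateFrom (cylinders N) = (inferInstance : MeasurableSpace (RCPath N)) := by
  apply le_antisymm
  · refine MeasurableSpace.generateFrom_le ?_
    rintro _ ⟨I, ζ, rfl⟩
    exact measurableSet_cyl I ζ
  · refine Measurable.comap_le ?_
    refine @measurable_pi_lambda _ _ _ (MeasurableSpace.generateFrom (cylinders N)) _ _ fun t => ?_
    refine @measurable_to_countable' _ _ _ _ (MeasurableSpace.generateFrom (cylinders N)) _
      fun z => ?_
    refine MeasurableSpace.measurableSet_generateFrom ⟨{t}, fun _ => z, ?_⟩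
    ext w; simp [cyl]

/-- Finite measures have a trivial spanning sequence in the cylinders. -/
noncomputable def spanningCylinders (μ : Measure (RCPath N)) [IsFiniteMeasure μ] :
    μ.FiniteSpanningSetsIn (cylinders N) where
  set _ := univ
  set_mem _ := ⟨∅, fun _ => 0, by simp [cyl]⟩
  finite _ := measure_lt_top _ _
  spanning := iUnion_const _

/-- Brings a finite set of times into the form that `IsCTMC.fdd` asks for; the sequence is constant
from index `n` on. -/
theorem exists_monotone_enumeration (I : Finset ℝ≥0) (h0 : 0 ∈ I) (T : ℝ≥0) (hT : T ∈ I)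
    (hI : ∀ s ∈ I, s ≤ T) :
    ∃ (n : ℕ) (t : ℕ → ℝ≥0), t 0 = 0 ∧ t n = T ∧ Monotone t ∧
      ∀ p : ℝ≥0 → Prop, (∀ s ∈ I, p s) ↔ ∀ i ≤ n, p (t i) := by
  obtain ⟨n, hn⟩ : ∃ n, I.card = n + 1 :=
    Nat.exists_eq_succ_of_ne_zero (Finset.card_ne_zero_of_mem h0)
  let e := I.orderEmbOfFin hn
  let t : ℕ → ℝ≥0 := fun i => e ⟨min i n, by omega⟩
  have hmono : Monotone t := fun i j hij => e.monotone (by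
    simp only [Fin.mk_le_mk]; exact min_le_min_right n hij)
  have hr : ∀ p : ℝ≥0 → Prop, (∀ s ∈ I, p s) ↔ ∀ i ≤ n, p (t i) := by
    intro p
    constructor
    · intro h i _
      exact h _ (Finset.orderEmbOfFin_mem I hn _)
    · intro h s hs
      obtain ⟨i, rfl⟩ : s ∈ Set.range e := by rw [Finset.range_orderEmbOfFin]; exact hs
      have := h i (by omega)
      have hi : min (i : ℕ) n = i := by omega
      simpa [t, hi] using this
  refine ⟨n, t, ?_, ?_, hmono, hr⟩
  · have : ¬ ∀ i ≤ n, t i ≠ 0 := fun h => (hr (· ≠ 0)).2 h 0 h0 rfl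
    push Not at this
    obtain ⟨i, -, hi⟩ := this
    exact le_antisymm ((hmono (Nat.zero_le i)).trans hi.le) zero_le
  · have : ¬ ∀ i ≤ n, t i ≠ T := fun h => (hr (· ≠ T)).2 h T hT rfl
    push Not at this
    obtain ⟨i, hin, hi⟩ := this
    exact le_antisymm ((hr (· ≤ T)).1 hI n le_rfl) (hi.symm.le.trans (hmono hin))

/-- The coordinate process on path space under `μ` is a Markov chain with rate matrix `G`. -/
abbrev IsChainLaw (G : Matrix (Fin (N + 1)) (Fin (N + 1)) ℝ)
    (μ : Fin (N + 1) → Measure (RCPath N)) : Prop :=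
  IsCTMC G μ fun t w => w.1 t

/-! ### The Markov property at a fixed time -/

section Markov

variable {G : Matrix (Fin (N + 1)) (Fin (N + 1)) ℝ} {μ : Fin (N + 1) → Measure (RCPath N)}

/-- The times of `I`, followed by those of `J` delayed by `T`, form one increasing sequence. Its
product of transition probabilities splits at index `n`, where the time is `T`, and the second
factor depends only on time differences. -/
theorem IsChainLaw.measureReal_cyl_inter (hμ : IsChainLaw G μ) (x : Fin (N + 1))
    {I J : Finset ℝ≥0} {ζ ξ : ℝ≥0 → Fin (N + 1)} {T : ℝ≥0} (h0 : 0 ∈ I) (hT : T ∈ I)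
    (hI : ∀ s ∈ I, s ≤ T) (hJ : 0 ∈ J) (hζ : ζ T = ξ 0) :
    (μ x).real (cyl I ζ ∩ RCPath.shift T ⁻¹' cyl J ξ) =
      (μ x).real (cyl I ζ) * (μ (ζ T)).real (cyl J ξ) := by
  obtain ⟨n, t, t0, tn, tm, tI⟩ := exists_monotone_enumeration I h0 T hT hI
  obtain ⟨m, t', t0', -, tm', tJ⟩ := exists_monotone_enumeration J hJ (J.max' ⟨0, hJ⟩)
    (J.max'_mem _) (fun s hs => J.le_max' s hs)
  let u : ℕ → ℝ≥0 := fun i => if i ≤ n then t i else T + t' (i - n)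
  let v : ℕ → Fin (N + 1) := fun i => if i ≤ n then ζ (t i) else ξ (t' (i - n))
  have u1 : ∀ i ≤ n, u i = t i := fun i hi => if_pos hi
  have v1 : ∀ i ≤ n, v i = ζ (t i) := fun i hi => if_pos hi
  have u2 : ∀ j, u (n + j) = T + t' j := by
    intro j
    rcases Nat.eq_zero_or_pos j with rfl | hj
    · simp [u, tn, t0']
    · simp only [u, if_neg (show ¬ n + j ≤ n by omega), Nat.add_sub_cancel_left]
  have v2 : ∀ j, v (n + j) = ξ (t' j) := by
    intro j
    rcases Nat.eq_zero_or_pos j with rfl | hj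
    · simp [v, tn, t0', hζ]
    · simp only [v, if_neg (show ¬ n + j ≤ n by omega), Nat.add_sub_cancel_left]
  have um : Monotone u := by
    refine monotone_nat_of_le_succ fun i => ?_
    rcases lt_or_ge i n with h | h
    · rw [u1 i h.le, u1 (i + 1) h]; exact tm (Nat.le_succ i)
    · obtain ⟨j, rfl⟩ := Nat.exists_eq_add_of_le h
      rw [u2, add_assoc, u2]; gcongr; exact tm' (Nat.le_succ j)
  have e1 : cyl I ζ = {w : RCPath N | ∀ i ≤ n, w.1 (t i) = ζ (t i)} := by
    ext w; exact tI fun s => w.1 s = ζ s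
  have e2 : cyl J ξ = {w : RCPath N | ∀ i ≤ m, w.1 (t' i) = ξ (t' i)} := by
    ext w; exact tJ fun s => w.1 s = ξ s
  have e3 : cyl I ζ ∩ RCPath.shift T ⁻¹' cyl J ξ =
      {w : RCPath N | ∀ i ≤ n + m, w.1 (u i) = v i} := by
    rw [e1, e2]
    ext w
    simp only [mem_inter_iff, mem_ofPred_eq, mem_preimage, RCPath.shift_apply]
    constructor
    · rintro ⟨ha, hb⟩ i hi
      rcases le_or_gt i n with h | h
      · rw [u1 i h, v1 i h, ha i h]
      · obtain ⟨j, rfl⟩ := Nat.exists_eq_add_of_lt h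
        rw [add_assoc, u2, v2, hb _ (by omega)]
    · intro h
      refine ⟨fun i hi => ?_, fun j hj => ?_⟩
      · rw [← v1 i hi, ← u1 i hi, h i (by omega)]
      · rw [← u2, ← v2, h _ (by omega)]
  have hu0 : u 0 = 0 := by rw [u1 0 (Nat.zero_le _), t0]
  rw [e3, e1, e2, hμ.fdd x (n + m) u v hu0 um,
    hμ.fdd x n t (fun i => ζ (t i)) t0 tm, hμ.fdd (ζ T) m t' (fun i => ξ (t' i)) t0' tm',
    Finset.prod_range_add, v1 0 (Nat.zero_le _), t0', if_pos hζ.symm, one_mul, mul_assoc]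
  congr 2
  · refine Finset.prod_congr rfl fun i hi => ?_
    rw [Finset.mem_range] at hi
    rw [u1 i hi.le, u1 (i + 1) hi, v1 i hi.le, v1 (i + 1) hi]
  · refine Finset.prod_congr rfl fun j _ => ?_
    rw [add_assoc, u2, u2, v2, v2]
    push_cast
    rw [add_sub_add_left_eq_sub]

theorem IsChainLaw.ae_start (hμ : IsChainLaw G μ) (x : Fin (N + 1)) :
    ∀ᵐ w ∂μ x, w.1 0 = x := by
  have := hμ.prob x
  have h := hμ.fdd x 0 (fun _ => 0) (fun _ => x) rfl monotone_const
  rw [if_pos rfl, Finset.range_zero, Finset.prod_empty, mul_one, measureReal_def,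
    ENNReal.toReal_eq_one_iff] at h
  have hm : MeasurableSet {w : RCPath N | w.1 0 = x} :=
    RCPath.measurable_coord 0 (measurableSet_singleton x)
  refine (mem_ae_iff_prob_eq_one hm).2 ?_
  rw [← h]
  congr 1
  ext w
  exact ⟨fun h i _ => h, fun h => h 0 le_rfl⟩

theorem IsChainLaw.measure_cyl_inter (hμ : IsChainLaw G μ) (x z : Fin (N + 1))
    (I J : Finset ℝ≥0) (ζ ξ : ℝ≥0 → Fin (N + 1)) (T : ℝ≥0) :
    μ x ({w | w.1 T = z} ∩ RCPath.freeze T ⁻¹' cyl I ζ ∩ RCPath.shift T ⁻¹' cyl J ξ) =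
      μ x ({w | w.1 T = z} ∩ RCPath.freeze T ⁻¹' cyl I ζ) * μ z (cyl J ξ) := by
  classical
  have hpr := hμ.prob
  -- If no path from `x` meets the first prescription, or none from `z` the second, both sides
  -- vanish. Otherwise such paths supply consistent values: `ζ` itself may be of no use, because all
  -- times after `T` read the frozen path at `T`.
  by_cases h1 : ∃ w₀ : RCPath N, w₀.1 0 = x ∧ w₀.1 T = z ∧ w₀.freeze T ∈ cyl I ζ
  swap
  · have hz : μ x ({w | w.1 T = z} ∩ RCPath.freeze T ⁻¹' cyl I ζ) = 0 := by
      refine measure_mono_null ?_ (hμ.ae_start x)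
      rintro w ⟨ha, hb⟩ hc
      exact h1 ⟨w, hc, ha, hb⟩
    rw [hz, zero_mul]
    exact measure_mono_null inter_subset_left hz
  by_cases h2 : ∃ w₁ : RCPath N, w₁.1 0 = z ∧ w₁ ∈ cyl J ξ
  swap
  · have hz : μ z (cyl J ξ) = 0 := by
      refine measure_mono_null ?_ (hμ.ae_start z)
      intro w ha hc
      exact h2 ⟨w, hc, ha⟩
    rw [hz, mul_zero]
    convert measure_empty (μ := μ x)
    rw [eq_empty_iff_forall_notMem]
    rintro w ⟨⟨ha, -⟩, hb⟩
    exact h2 ⟨w.shift T, by simpa using ha, hb⟩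
  obtain ⟨w₀, w0x, w0T, w0I⟩ := h1
  obtain ⟨w₁, w1z, w1J⟩ := h2
  have key := hμ.measureReal_cyl_inter x (I := insert 0 (insert T (I.image (min · T))))
    (J := insert 0 J) (ζ := w₀.1) (ξ := w₁.1) (T := T) (by simp) (by simp) (by simp) (by simp)
    (w0T.trans w1z.symm)
  rw [measureReal_def, measureReal_def, measureReal_def, ← ENNReal.toReal_mul,
    ENNReal.toReal_eq_toReal_iff' (measure_ne_top _ _)
      (ENNReal.mul_ne_top (measure_ne_top _ _) (measure_ne_top _ _)), w0T] at key
  simp only [cyl, mem_ofPred_eq, RCPath.freeze_apply] at w0I w1J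
  have eI : ∀ w : RCPath N, w.1 0 = x →
      (w ∈ cyl (insert 0 (insert T (I.image (min · T)))) w₀.1 ↔
        w ∈ {w : RCPath N | w.1 T = z} ∩ RCPath.freeze T ⁻¹' cyl I ζ) := by
    intro w hw
    simp only [cyl, Finset.forall_mem_insert, Finset.forall_mem_image, mem_ofPred_eq, w0x, w0T, hw,
      mem_inter_iff, mem_preimage, RCPath.freeze_apply, true_and]
    refine and_congr_right fun _ => forall₂_congr fun s hs => ?_
    rw [w0I s hs]
  have eJ : ∀ w : RCPath N, w.1 0 = z → (w ∈ cyl (insert 0 J) w₁.1 ↔ w ∈ cyl J ξ) := by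
    intro w hw
    simp only [cyl, Finset.forall_mem_insert, mem_ofPred_eq, w1z, hw, true_and]
    refine forall₂_congr fun s hs => ?_
    rw [w1J s hs]
  convert key using 1
  · refine measure_congr ?_
    filter_upwards [hμ.ae_start x] with w hw
    refine propext ?_
    change _ ∧ _ ↔ _ ∧ _
    refine ⟨fun h => ⟨(eI w hw).2 h.1, (eJ _ (by simpa using h.1.1)).2 h.2⟩, fun h => ?_⟩
    have h1 := (eI w hw).1 h.1
    exact ⟨h1, (eJ _ (by simpa using h1.1)).1 h.2⟩
  · congr 1
    · refine measure_congr ?_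
      filter_upwards [hμ.ae_start x] with w hw
      exact propext (eI w hw).symm
    · refine measure_congr ?_
      filter_upwards [hμ.ae_start z] with w hw
      exact propext (eJ w hw).symm

/-- The Markov property at a fixed time. -/
theorem IsChainLaw.markov (hμ : IsChainLaw G μ) (x z : Fin (N + 1)) (T : ℝ≥0)
    {E A : Set (RCPath N)} (hE : MeasurableSet E) (hA : MeasurableSet A) :
    μ x ({w | w.1 T = z} ∩ RCPath.freeze T ⁻¹' E ∩ RCPath.shift T ⁻¹' A) =
      μ x ({w | w.1 T = z} ∩ RCPath.freeze T ⁻¹' E) * μ z A := by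
  have hpr := hμ.prob
  have hz : MeasurableSet {w : RCPath N | w.1 T = z} :=
    RCPath.measurable_coord T (measurableSet_singleton z)
  have hs := RCPath.measurable_freeze (N := N) T
  have hsh := RCPath.measurable_shift (N := N) T
  -- On `{w T = z}` the joint law of past and future is a product measure; it suffices to check this
  -- on rectangles of cylinders.
  have key : (((μ x).restrict {w | w.1 T = z}).map (RCPath.freeze T)).prod (μ z) =
      ((μ x).restrict {w | w.1 T = z}).map fun w => (w.freeze T, w.shift T) := by
    refine Measure.prod_eq_generateFrom generateFrom_cylinders generateFrom_cylinders
      isPiSystem_cylinders isPiSystem_cylinders (spanningCylinders _) (spanningCylinders _) ?_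
    rintro _ ⟨I, ζ, rfl⟩ _ ⟨J, ξ, rfl⟩
    have mI := measurableSet_cyl I ζ
    have mJ := measurableSet_cyl J ξ
    rw [Measure.map_apply (hs.prodMk hsh) (mI.prod mJ), Measure.map_apply hs mI,
      Measure.restrict_apply (hs mI), Measure.restrict_apply ((hs.prodMk hsh) (mI.prod mJ)),
      inter_comm (RCPath.freeze T ⁻¹' _), ← hμ.measure_cyl_inter, inter_comm, inter_assoc]
    rfl
  have := congrArg (fun m => m (E ×ˢ A)) key
  simp only [Measure.prod_prod] at this
  rw [Measure.map_apply (hs.prodMk hsh) (hE.prod hA), Measure.map_apply hs hE,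
    Measure.restrict_apply (hs hE), Measure.restrict_apply ((hs.prodMk hsh) (hE.prod hA))] at this
  rw [inter_comm {w : RCPath N | w.1 T = z}, this, inter_comm, inter_comm _ {w : RCPath N | w.1 T = z},
    inter_comm, inter_assoc, inter_left_comm]
  congr 1
  ext w
  simp only [mem_inter_iff, mem_preimage, mem_prod]
  tauto

end Markov

/-! ### Optional times and the strong Markov property -/

/-- `T` is an optional time: whether `T < s` can be read off the path up to time `s`. -/
structure IsOptionalTime (T : RCPath N → ℝ≥0∞) : Prop where
  measurable : Measurable T
  lt_iff : ∀ (w : RCPath N) (s : ℝ≥0), T w < s ↔ T (w.freeze s) < s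

theorem RCPath.freeze_freeze (w : RCPath N) {r t : ℝ≥0} (h : r ≤ t) :
    (w.freeze t).freeze r = w.freeze r := by
  ext s
  simp [min_assoc, min_eq_left h]

theorem IsOptionalTime.lt_iff_of_le {T : RCPath N → ℝ≥0∞} (hT : IsOptionalTime T) (w : RCPath N)
    {r t : ℝ≥0} (h : r ≤ t) : T w < r ↔ T (w.freeze t) < r := by
  rw [hT.lt_iff w r, hT.lt_iff (w.freeze t) r, w.freeze_freeze h]

theorem IsOptionalTime.measurable_toNNReal {T : RCPath N → ℝ≥0∞} (hT : IsOptionalTime T) :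
    Measurable fun w => (T w).toNNReal := hT.measurable.ennreal_toNNReal

section StrongMarkov

variable {G : Matrix (Fin (N + 1)) (Fin (N + 1)) ℝ} {μ : Fin (N + 1) → Measure (RCPath N)}

/-- The strong Markov property at the discretised times `gridCeil m T`. -/
theorem IsChainLaw.markov_gridCeil (hμ : IsChainLaw G μ) {T : RCPath N → ℝ≥0∞}
    (hT : IsOptionalTime T) (x z : Fin (N + 1)) (m : ℕ) (c : ℝ≥0) {A : Set (RCPath N)}
    (hA : MeasurableSet A) :
    μ x {w | T w < c ∧ w.1 (gridCeil m (T w).toNNReal) = z ∧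
        w.shift (gridCeil m (T w).toNNReal) ∈ A} =
      μ x {w | T w < c ∧ w.1 (gridCeil m (T w).toNNReal) = z} * μ z A := by
  have hpr := hμ.prob
  let r : ℕ → ℝ≥0 := fun k => (k : ℝ≥0) / (m + 1)
  let t : ℕ → ℝ≥0 := fun k => ((k : ℝ≥0) + 1) / (m + 1)
  have hrt : ∀ k, r k ≤ t k := fun k => by simp only [r, t]; gcongr; exact le_self_add
  -- `E k` is the event that `T < c` and the discretised time is `t k`. It is determined by the path
  -- up to `t k`, so the Markov property at `t k` applies.
  let E : ℕ → Set (RCPath N) := fun k => {w | ¬ T w < r k ∧ T w < (min c (t k) : ℝ≥0)}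
  have mE : ∀ k, MeasurableSet (E k) := fun k =>
    (measurableSet_lt hT.measurable measurable_const).compl.inter
      (measurableSet_lt hT.measurable measurable_const)
  have freezeE : ∀ k, RCPath.freeze (t k) ⁻¹' E k = E k := by
    intro k
    ext w
    simp only [E, mem_preimage, mem_ofPred_eq, ← hT.lt_iff_of_le w (hrt k),
      ← hT.lt_iff_of_le w (min_le_right c (t k))]
  have memE : ∀ k w, w ∈ E k ↔ T w < c ∧ gridCeil m (T w).toNNReal = t k := by
    intro k w
    simp only [E, mem_ofPred_eq, t, gridCeil_eq_iff]
    constructor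
    · rintro ⟨h1, h2⟩
      have hw : T w ≠ ⊤ := h2.ne_top
      lift T w to ℝ≥0 using hw with τ
      simp only [ENNReal.coe_lt_coe, lt_min_iff, not_lt, ENNReal.toNNReal_coe] at *
      exact ⟨h2.1, h1, h2.2⟩
    · rintro ⟨h2, h1, h3⟩
      have hw : T w ≠ ⊤ := h2.ne_top
      lift T w to ℝ≥0 using hw with τ
      simp only [ENNReal.coe_lt_coe, lt_min_iff, not_lt, ENNReal.toNNReal_coe] at *
      exact ⟨h1, h2, h3⟩
  have tinj : Function.Injective t := by
    intro i j hij
    simp only [t] at hij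
    rwa [div_left_inj' (by positivity), add_left_inj, Nat.cast_inj] at hij
  have decomp : ∀ A : Set (RCPath N), MeasurableSet A →
      μ x {w | T w < c ∧ w.1 (gridCeil m (T w).toNNReal) = z ∧
        w.shift (gridCeil m (T w).toNNReal) ∈ A} =
      ∑' k, μ x ({w | w.1 (t k) = z} ∩ RCPath.freeze (t k) ⁻¹' E k ∩ RCPath.shift (t k) ⁻¹' A) := by
    intro A hA
    rw [← measure_iUnion]
    · congr 1
      ext w
      simp only [freezeE, mem_iUnion, mem_inter_iff, memE, mem_preimage, mem_ofPred_eq]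
      constructor
      · rintro ⟨h1, h2, h3⟩
        have hk : gridCeil m (T w).toNNReal = t ⌊((m : ℝ≥0) + 1) * (T w).toNNReal⌋₊ := rfl
        exact ⟨_, ⟨hk ▸ h2, h1, hk⟩, hk ▸ h3⟩
      · rintro ⟨k, ⟨h2, h1, hk⟩, h3⟩
        rw [hk]
        exact ⟨h1, h2, h3⟩
    · intro i j hij
      rw [Function.onFun, Set.disjoint_left]
      rintro w ⟨⟨-, hi⟩, -⟩ ⟨⟨-, hj⟩, -⟩
      rw [freezeE, memE] at hi hj
      exact hij (tinj (hi.2.symm.trans hj.2))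
    · intro k
      rw [freezeE]
      exact ((RCPath.measurable_coord _ (measurableSet_singleton z)).inter (mE k)).inter
        (RCPath.measurable_shift _ hA)
  -- With `A = univ` the decomposition computes the first factor on the right-hand side.
  have d1 := decomp univ MeasurableSet.univ
  simp only [mem_univ, and_true, preimage_univ, inter_univ] at d1
  rw [decomp A hA, d1, ← ENNReal.tsum_mul_right]
  exact tsum_congr fun k => hμ.markov x z (t k) (mE k) hA

theorem IsOptionalTime.measurableSet_eval {T : RCPath N → ℝ≥0∞} (hT : IsOptionalTime T)
    (z : Fin (N + 1)) : MeasurableSet {w : RCPath N | T w < ⊤ ∧ w.1 (T w).toNNReal = z} :=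
  (measurableSet_lt hT.measurable measurable_const).inter
    (RCPath.measurable_eval hT.measurable_toNNReal (measurableSet_singleton z))

/-- Limit `m → ∞` of `IsChainLaw.markov_gridCeil`. A cylinder involves finitely many times, so for
each path the discretised events eventually agree with the limiting event, and their measures
converge. -/
theorem IsChainLaw.strongMarkov_cyl (hμ : IsChainLaw G μ) {T : RCPath N → ℝ≥0∞}
    (hT : IsOptionalTime T) (x z : Fin (N + 1)) (c : ℝ≥0) (J : Finset ℝ≥0)
    (ξ : ℝ≥0 → Fin (N + 1)) :
    μ x {w | T w < c ∧ w.1 (T w).toNNReal = z ∧ w.shift (T w).toNNReal ∈ cyl J ξ} =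
      μ x {w | T w < c ∧ w.1 (T w).toNNReal = z} * μ z (cyl J ξ) := by
  have hpr := hμ.prob
  have mT := hT.measurable_toNNReal
  have mG : ∀ m, Measurable fun w : RCPath N => gridCeil m (T w).toNNReal := by
    intro m
    have h : Measurable fun w => ((⌊((m : ℝ≥0) + 1) * (T w).toNNReal⌋₊ : ℕ) : ℝ≥0) :=
      measurable_from_top.comp (Nat.measurable_floor.comp (mT.const_mul _))
    exact (h.add_const 1).div_const _
  have mc : MeasurableSet {w : RCPath N | T w < c} := measurableSet_lt hT.measurable measurable_const
  have hev : ∀ (w : RCPath N) (s : ℝ≥0), ∀ᶠ m in atTop,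
      w.1 (gridCeil m (T w).toNNReal + s) = w.1 ((T w).toNNReal + s) := by
    intro w s
    have := (tendsto_gridCeil (T w).toNNReal).eventually ((w.shift s).2 (T w).toNNReal)
    simpa only [RCPath.shift_apply, add_comm s] using this
  have hcyl : ∀ w : RCPath N, ∀ᶠ m in atTop,
      (w.shift (gridCeil m (T w).toNNReal) ∈ cyl J ξ ↔ w.shift (T w).toNNReal ∈ cyl J ξ) := by
    intro w
    filter_upwards [(eventually_all_finset J).2 fun s _ => hev w s] with m hm
    simp only [cyl, mem_ofPred_eq, RCPath.shift_apply]
    exact forall₂_congr fun s hs => by rw [hm s hs]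
  have h1 : Tendsto (fun m => μ x {w | T w < c ∧ w.1 (gridCeil m (T w).toNNReal) = z ∧
        w.shift (gridCeil m (T w).toNNReal) ∈ cyl J ξ}) atTop
      (𝓝 (μ x {w | T w < c ∧ w.1 (T w).toNNReal = z ∧ w.shift (T w).toNNReal ∈ cyl J ξ})) := by
    refine tendsto_measure_of_tendsto_indicator_of_isFiniteMeasure atTop (μ x) (fun m => ?_) fun w => ?_
    · exact mc.inter ((RCPath.measurable_eval (mG m) (measurableSet_singleton z)).inter
        (RCPath.measurable_shift_random (mG m) (measurableSet_cyl J ξ)))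
    · filter_upwards [hev w 0, hcyl w] with m ha hb
      simp only [add_zero] at ha
      simp only [ha, hb]
  have h2 : Tendsto (fun m => μ x {w | T w < c ∧ w.1 (gridCeil m (T w).toNNReal) = z}) atTop
      (𝓝 (μ x {w | T w < c ∧ w.1 (T w).toNNReal = z})) := by
    refine tendsto_measure_of_tendsto_indicator_of_isFiniteMeasure atTop (μ x) (fun m => ?_) fun w => ?_
    · exact mc.inter (RCPath.measurable_eval (mG m) (measurableSet_singleton z))
    · filter_upwards [hev w 0] with m ha
      simp only [add_zero] at ha
      simp only [ha]
  have h3 := ENNReal.Tendsto.mul_const h2 (b := μ z (cyl J ξ)) (.inr (measure_ne_top _ _))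
  refine tendsto_nhds_unique h1 (h3.congr fun m => ?_)
  exact (hμ.markov_gridCeil hT x z m c (measurableSet_cyl J ξ)).symm

/-- The strong Markov property: given that `T` is finite and the chain is in `z` at time `T`,
the time `T` and the path after `T` are independent, and the latter has the law `μ z`. -/
theorem IsChainLaw.strongMarkov (hμ : IsChainLaw G μ) {T : RCPath N → ℝ≥0∞}
    (hT : IsOptionalTime T) (x z : Fin (N + 1)) :
    (((μ x).restrict {w | T w < ⊤ ∧ w.1 (T w).toNNReal = z}).map
        fun w => (T w).toNNReal).prod (μ z) =
      ((μ x).restrict {w | T w < ⊤ ∧ w.1 (T w).toNNReal = z}).map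
        fun w => ((T w).toNNReal, w.shift (T w).toNNReal) := by
  have hpr := hμ.prob
  have mT := hT.measurable_toNNReal
  have mS := mT.prodMk (RCPath.measurable_shift_random mT)
  have hlt : ∀ (w : RCPath N) (c : ℝ≥0), T w < ⊤ → ((T w).toNNReal < c ↔ T w < c) := by
    intro w c h
    lift T w to ℝ≥0 using h.ne with τ
    simp
  refine Measure.prod_eq_generateFrom (C := range Iio)
    ((borel_eq_generateFrom_Iio ℝ≥0).symm.trans (BorelSpace.measurable_eq).symm)
    generateFrom_cylinders isPiSystem_Iio isPiSystem_cylinders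
    ⟨fun n => Iio (n : ℝ≥0), fun n => ⟨_, rfl⟩, fun n => measure_lt_top _ _, ?_⟩
    (spanningCylinders _) ?_
  · refine eq_univ_of_forall fun r => mem_iUnion.2 ?_
    exact exists_nat_gt r
  · rintro _ ⟨c, rfl⟩ _ ⟨J, ξ, rfl⟩
    have mJ := measurableSet_cyl J ξ
    rw [Measure.map_apply mS (measurableSet_Iio.prod mJ), Measure.map_apply mT measurableSet_Iio,
      Measure.restrict_apply (mT measurableSet_Iio),
      Measure.restrict_apply (mS (measurableSet_Iio.prod mJ))]
    convert hμ.strongMarkov_cyl hT x z c J ξ using 2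
    · ext w
      simp only [mem_inter_iff, mem_preimage, mem_prod, mem_Iio, mem_ofPred_eq]
      constructor
      · rintro ⟨⟨h1, h2⟩, h3, h4⟩
        exact ⟨(hlt w c h3).1 h1, h4, h2⟩
      · rintro ⟨h1, h4, h2⟩
        have h3 : T w < ⊤ := h1.trans ENNReal.coe_lt_top
        exact ⟨⟨(hlt w c h3).2 h1, h2⟩, h3, h4⟩
    · congr 1
      ext w
      simp only [mem_inter_iff, mem_preimage, mem_Iio, mem_ofPred_eq]
      constructor
      · rintro ⟨h1, h3, h4⟩
        exact ⟨(hlt w c h3).1 h1, h4⟩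
      · rintro ⟨h1, h4⟩
        have h3 : T w < ⊤ := h1.trans ENNReal.coe_lt_top
        exact ⟨(hlt w c h3).2 h1, h3, h4⟩

theorem IsChainLaw.setIntegral_strongMarkov (hμ : IsChainLaw G μ) {T : RCPath N → ℝ≥0∞}
    (hT : IsOptionalTime T) (x z : Fin (N + 1)) {φ : ℝ≥0 → ℂ} (hφ : Measurable φ)
    {F : RCPath N → ℂ} (hF : Measurable F) :
    ∫ w in {w | T w < ⊤ ∧ w.1 (T w).toNNReal = z},
        φ (T w).toNNReal * F (w.shift (T w).toNNReal) ∂μ x =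
      (∫ w in {w | T w < ⊤ ∧ w.1 (T w).toNNReal = z}, φ (T w).toNNReal ∂μ x) *
        ∫ w, F w ∂μ z := by
  have hpr := hμ.prob
  have mT := hT.measurable_toNNReal
  have mS := mT.prodMk (RCPath.measurable_shift_random mT)
  have hφF : Measurable fun p : ℝ≥0 × RCPath N => φ p.1 * F p.2 :=
    (hφ.comp measurable_fst).mul (hF.comp measurable_snd)
  have h := congrArg (fun m => ∫ p, φ p.1 * F p.2 ∂m) (hμ.strongMarkov hT x z)
  rw [integral_prod_mul, integral_map mT.aemeasurable hφ.aestronglyMeasurable,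
    integral_map mS.aemeasurable hφF.aestronglyMeasurable] at h
  exact h.symm

end StrongMarkov

/-! ### Maxima over time windows -/

section Window

theorem windowMax_le_iff {w : ℝ≥0 → Fin (N + 1)} {s t : ℝ≥0} {z : Fin (N + 1)} :
    windowMax w s t ≤ z ↔ ∀ u, s ≤ u → u ≤ t → w u ≤ z := by
  simp only [windowMax, iSup_le_iff, mem_Icc, and_imp]

theorem le_windowMax (w : ℝ≥0 → Fin (N + 1)) {s t u : ℝ≥0} (h1 : s ≤ u) (h2 : u ≤ t) :
    w u ≤ windowMax w s t := windowMax_le_iff.1 le_rfl u h1 h2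

theorem windowMax_self (w : ℝ≥0 → Fin (N + 1)) (s : ℝ≥0) : windowMax w s s = w s := by
  refine le_antisymm (windowMax_le_iff.2 fun u h1 h2 => ?_) (le_windowMax w le_rfl le_rfl)
  rw [le_antisymm h2 h1]

theorem windowMax_shift (w : ℝ≥0 → Fin (N + 1)) (T s t : ℝ≥0) :
    windowMax w (T + s) (T + t) = windowMax (fun u => w (T + u)) s t := by
  refine eq_of_forall_ge_iff fun c => ?_
  simp only [windowMax_le_iff]
  constructor
  · intro h u h1 h2
    exact h _ (by gcongr) (by gcongr)
  · intro h u h1 h2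
    obtain ⟨v, rfl⟩ := exists_add_of_le (le_self_add.trans h1)
    exact h v (le_of_add_le_add_left h1) (le_of_add_le_add_left h2)

theorem runMax_le_iff {y z : Fin (N + 1)} {w : ℝ≥0 → Fin (N + 1)} {t : ℝ≥0} :
    runMax y w t ≤ z ↔ y ≤ z ∧ ∀ u ≤ t, w u ≤ z := by
  simp only [runMax, max_le_iff, windowMax_le_iff, zero_le, forall_const]

theorem runMax_zero (y : Fin (N + 1)) (w : ℝ≥0 → Fin (N + 1)) :
    runMax y w 0 = max y (w 0) := by
  rw [runMax, windowMax_self]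

theorem isRightStep_windowMax {w : ℝ≥0 → Fin (N + 1)} (hw : IsRightStep w) (s : ℝ≥0) :
    IsRightStep (windowMax w s) := by
  refine isRightStep_of_exists fun t => ?_
  rcases lt_or_ge t s with h | h
  · refine ⟨s, h, fun t' h1 h2 => eq_of_forall_ge_iff fun c => ?_⟩
    simp only [windowMax_le_iff]
    exact ⟨fun _ u h3 h4 => absurd (h3.trans h4) h.not_ge,
      fun _ u h3 h4 => absurd (h3.trans h4) h2.not_ge⟩
  · obtain ⟨v, h1, -, hv⟩ := hw.exists_Ico (lt_add_one t)
    refine ⟨v, h1, fun t' h2 h3 => eq_of_forall_ge_iff fun c => ?_⟩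
    simp only [windowMax_le_iff]
    refine ⟨fun H u h4 h5 => H u h4 (h5.trans h2), fun H u h4 h5 => ?_⟩
    rcases le_total u t with h6 | h6
    · exact H u h4 h6
    · rw [hv u h6 (h5.trans_lt h3)]
      exact H t h le_rfl

theorem isRightStep_runMax {w : ℝ≥0 → Fin (N + 1)} (hw : IsRightStep w) (y : Fin (N + 1)) :
    IsRightStep (runMax y w) := by
  intro t
  filter_upwards [isRightStep_windowMax hw 0 t] with s hs
  rw [runMax, hs, runMax]

/-- The right end is `max s r` so that the window stays nonempty as its left end passes `r`; from
then on the maximum is just the current state. -/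
theorem isRightStep_windowMax_left {w : ℝ≥0 → Fin (N + 1)} (hw : IsRightStep w) (r : ℝ≥0) :
    IsRightStep fun s => windowMax w s (max s r) := by
  refine isRightStep_of_exists fun t => ?_
  rcases lt_or_ge t r with h | h
  · obtain ⟨v, h1, h0, hv⟩ := hw.exists_Ico h
    refine ⟨v, h1, fun t' h2 h3 => eq_of_forall_ge_iff fun c => ?_⟩
    simp only [windowMax_le_iff, max_eq_right h.le, max_eq_right (h3.le.trans h0)]
    refine ⟨fun H u h4 h5 => ?_, fun H u h4 h5 => H u (h2.trans h4) h5⟩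
    rcases le_total t' u with h6 | h6
    · exact H u h6 h5
    · rw [hv u h4 (h6.trans_lt h3), ← hv t' h2 h3]
      exact H t' le_rfl (h3.le.trans h0)
  · obtain ⟨v, h1, -, hv⟩ := hw.exists_Ico (lt_add_one t)
    refine ⟨v, h1, fun t' h2 h3 => ?_⟩
    simp only [max_eq_left h, max_eq_left (h.trans h2), windowMax_self, hv t' h2 h3]

theorem measurable_windowMax (s t : ℝ≥0) :
    Measurable fun w : RCPath N => windowMax w.1 s t := by
  rcases lt_or_ge t s with h | h
  · convert measurable_const (a := (⊥ : Fin (N + 1))) using 2 with w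
    rw [← le_bot_iff, windowMax_le_iff]
    exact fun u h1 h2 => absurd (h1.trans h2) h.not_ge
  let d := TopologicalSpace.denseSeq ℝ≥0
  refine measurable_of_Iic fun z => ?_
  -- The right end `t` is tested separately: right-continuity lets dense times inside the window
  -- control every earlier time, but not `t`.
  have : (fun w : RCPath N => windowMax w.1 s t) ⁻¹' Iic z =
      (fun w => w.1 t) ⁻¹' Iic z ∩
        ⋂ (n : ℕ) (_ : s ≤ d n ∧ d n ≤ t), (fun w => w.1 (d n)) ⁻¹' Iic z := by
    ext w
    simp only [mem_preimage, mem_Iic, mem_inter_iff, mem_iInter, windowMax_le_iff]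
    refine ⟨fun H => ⟨H t h le_rfl, fun n hn => H _ hn.1 hn.2⟩, fun ⟨H1, H2⟩ u h1 h2 => ?_⟩
    rcases h2.eq_or_lt with rfl | h2
    · exact H1
    obtain ⟨v, h3, h4, hv⟩ := w.2.exists_Ico h2
    obtain ⟨_, ⟨n, rfl⟩, h5, h6⟩ := (TopologicalSpace.denseRange_denseSeq ℝ≥0).exists_between h3
    rw [← hv _ h5.le h6]
    exact H2 n ⟨h1.trans h5.le, h6.le.trans h4⟩
  rw [this]
  exact (RCPath.measurable_coord t measurableSet_Iic).inter
    (.iInter fun n => .iInter fun _ => RCPath.measurable_coord _ measurableSet_Iic)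

theorem measurable_runMax (y : Fin (N + 1)) (t : ℝ≥0) :
    Measurable fun w : RCPath N => runMax y w.1 t :=
  (measurable_of_countable fun z => max y z).comp (measurable_windowMax 0 t)

end Window

/-! ### First times at which a condition holds -/

section Infimum

theorem iInf_time_lt_iff {p : ℝ≥0 → Prop} {c : ℝ≥0∞} :
    (⨅ (t : ℝ≥0) (_ : p t), (t : ℝ≥0∞)) < c ↔ ∃ t, p t ∧ (t : ℝ≥0∞) < c := by
  simp only [iInf_lt_iff, exists_prop]

/-- The first time at which a right-open condition holds is measurable. -/
theorem measurable_iInf_time {α : Type*} [MeasurableSpace α] {p : ℝ≥0 → α → Prop}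
    (hp : ∀ t, MeasurableSet {ω | p t ω}) (hr : ∀ t ω, p t ω → ∀ᶠ s in 𝓝[≥] t, p s ω) :
    Measurable fun ω => ⨅ (t : ℝ≥0) (_ : p t ω), (t : ℝ≥0∞) := by
  let d := TopologicalSpace.denseSeq ℝ≥0
  refine measurable_of_Iio fun c => ?_
  have : (fun ω => ⨅ (t : ℝ≥0) (_ : p t ω), (t : ℝ≥0∞)) ⁻¹' Iio c =
      ⋃ (n : ℕ) (_ : (d n : ℝ≥0∞) < c), {ω | p (d n) ω} := by
    ext ω
    simp only [mem_preimage, mem_Iio, iInf_time_lt_iff, mem_iUnion, mem_ofPred_eq, exists_prop]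
    constructor
    · rintro ⟨t, h1, h2⟩
      obtain ⟨c', h3, h4⟩ := ENNReal.lt_iff_exists_nnreal_btwn.1 h2
      obtain ⟨u, hu, h⟩ :=
        (mem_nhdsGE_iff_exists_mem_Ioc_Ico_subset (ENNReal.coe_lt_coe.1 h3)).1 (hr t ω h1)
      obtain ⟨_, ⟨n, rfl⟩, h5, h6⟩ :=
        (TopologicalSpace.denseRange_denseSeq ℝ≥0).exists_between hu.1
      refine ⟨n, ?_, h ⟨h5.le, h6⟩⟩
      exact (ENNReal.coe_lt_coe.2 (h6.trans_le hu.2)).trans h4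
    · rintro ⟨n, h1, h2⟩
      exact ⟨_, h2, h1⟩
  rw [this]
  exact .iUnion fun n => .iUnion fun _ => hp (d n)

theorem iInf_time_shift {p p' : ℝ≥0 → Prop} {T : ℝ≥0} (h1 : ∀ t, p t → T ≤ t)
    (h2 : ∀ s, p (T + s) ↔ p' s) :
    (⨅ (t : ℝ≥0) (_ : p t), (t : ℝ≥0∞)) = T + ⨅ (t : ℝ≥0) (_ : p' t), (t : ℝ≥0∞) := by
  refine eq_of_forall_gt_iff fun c => ?_
  rw [iInf_time_lt_iff, ← lt_tsub_iff_left, iInf_time_lt_iff]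
  constructor
  · rintro ⟨t, ht, hc⟩
    obtain ⟨s, rfl⟩ := exists_add_of_le (h1 t ht)
    exact ⟨s, (h2 s).1 ht, lt_tsub_iff_left.2 (by simpa using hc)⟩
  · rintro ⟨s, hs, hc⟩
    exact ⟨T + s, (h2 s).2 hs, by simpa using lt_tsub_iff_left.1 hc⟩

end Infimum

/-! ### First passage times -/

section FirstPassage

variable {grid : Fin (N + 1) → ℝ} {S : Set ℝ}

theorem firstPassage_lt_iff {w : ℝ≥0 → Fin (N + 1)} {c : ℝ≥0∞} :
    firstPassage grid S w < c ↔ ∃ t, (0 < t ∧ grid (w t) ∉ S) ∧ (t : ℝ≥0∞) < c :=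
  iInf_time_lt_iff

/-- The infimum is below `s` iff the path is outside `S` at some positive time before `s`, and
freezing at `s` does not change the path before `s`. -/
theorem isOptionalTime_firstPassage (grid : Fin (N + 1) → ℝ) (S : Set ℝ) :
    IsOptionalTime fun w : RCPath N => firstPassage grid S w.1 where
  measurable := by
    refine measurable_iInf_time (fun t => ?_) fun t w ht => ?_
    · exact (MeasurableSet.const _).inter
        (RCPath.measurable_coord t (MeasurableSet.of_discrete (s := {z | grid z ∉ S})))
    · filter_upwards [w.2 t, self_mem_nhdsWithin] with s hs hts
      rw [hs]
      exact ⟨ht.1.trans_le hts, ht.2⟩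
  lt_iff w s := by
    simp only [firstPassage_lt_iff, RCPath.freeze_apply, ENNReal.coe_lt_coe]
    refine exists_congr fun t => and_congr_left fun ht => ?_
    rw [min_eq_left ht.le]

/-- Time `0` is included although the infimum runs over positive times: a path outside `S` at `t`
stays there for a while, which would put the infimum at or below `t`. -/
theorem mem_of_lt_firstPassage {w : ℝ≥0 → Fin (N + 1)} (hw : IsRightStep w) {t : ℝ≥0}
    (ht : t < firstPassage grid S w) : grid (w t) ∈ S := by
  by_contra h
  obtain ⟨c, h3, h4⟩ := ENNReal.lt_iff_exists_nnreal_btwn.1 ht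
  obtain ⟨u, h1, h2, hu⟩ := hw.exists_Ico (ENNReal.coe_lt_coe.1 h3)
  obtain ⟨v, h5, h6⟩ := exists_between h1
  refine lt_irrefl (firstPassage grid S w) (firstPassage_lt_iff.2
    ⟨v, ⟨(zero_le : 0 ≤ t).trans_lt h5, ?_⟩, ?_⟩)
  · rwa [hu v h5.le h6]
  · exact (ENNReal.coe_lt_coe.2 (h6.trans_le h2)).trans h4

/-- Exit times decrease to `T`, and the path is constant just after `T`, so its value at `T` is
already an exit value. -/
theorem notMem_firstPassage {w : ℝ≥0 → Fin (N + 1)} (hw : IsRightStep w) {T : ℝ≥0}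
    (hT : firstPassage grid S w = T) : grid (w T) ∉ S := by
  obtain ⟨u, h1, -, hu⟩ := hw.exists_Ico (lt_add_one T)
  obtain ⟨t, ⟨h2, h3⟩, h4⟩ := firstPassage_lt_iff.1
    (hT.trans_lt (ENNReal.coe_lt_coe.2 h1))
  have h5 : T ≤ t := by
    rw [← ENNReal.coe_le_coe, ← hT]
    exact iInf₂_le t ⟨h2, h3⟩
  rwa [hu t h5 (ENNReal.coe_lt_coe.1 h4)] at h3

theorem passagePayoff_const (q : ℂ) (g : Fin (N + 1) → ℂ) (w : ℝ≥0 → Fin (N + 1)) :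
    passagePayoff grid S (fun _ => q) g w =
      if firstPassage grid S w < ⊤ then
        Complex.exp (-(q * ((firstPassage grid S w).toReal : ℂ))) *
          g (w (firstPassage grid S w).toNNReal)
      else 0 := by
  simp only [passagePayoff, intervalIntegral.integral_const, sub_zero, Complex.real_smul, mul_comm]

end FirstPassage

/-! ### Drawdown times: measurability, bounds and renewal -/

section Drawdown

variable {grid : Fin (N + 1) → ℝ} {a : ℝ}

theorem drawdownTime_succ (y : Fin (N + 1)) (w : ℝ≥0 → Fin (N + 1)) (n : ℕ) :
    drawdownTime grid a y w (n + 1) =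
      ⨅ (t : ℝ≥0) (_ : drawdownTime grid a y w n < (t : ℝ≥0∞) ∧
        a ≤ grid (runMax y w t) - grid (w t) ∧
        runMax y w (drawdownTime grid a y w n).toNNReal ≤
          windowMax w (drawdownTime grid a y w n).toNNReal t), (t : ℝ≥0∞) := rfl

theorem drawdownTime_succ_eq_top {y : Fin (N + 1)} {w : ℝ≥0 → Fin (N + 1)} {n : ℕ}
    (h : drawdownTime grid a y w n = ⊤) : drawdownTime grid a y w (n + 1) = ⊤ := by
  rw [drawdownTime_succ, h]
  simp

theorem drawdownTime_eq_top_of_le {y : Fin (N + 1)} {w : ℝ≥0 → Fin (N + 1)} {m n : ℕ}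
    (hmn : m ≤ n) (h : drawdownTime grid a y w m = ⊤) : drawdownTime grid a y w n = ⊤ := by
  induction n, hmn using Nat.le_induction with
  | base => exact h
  | succ n _ ih => exact drawdownTime_succ_eq_top ih

/-- By induction. At a fixed `t` the defining condition evaluates right-step processes at the
previous, measurable drawdown time, and once the condition holds it persists for a while. -/
theorem measurable_drawdownTime (grid : Fin (N + 1) → ℝ) (a : ℝ) (y : Fin (N + 1)) (n : ℕ) :
    Measurable fun w : RCPath N => drawdownTime grid a y w.1 n := by
  induction n with
  | zero => exact measurable_const
  | succ n ih =>
    refine measurable_iInf_time (fun t => ?_) fun t w ht => ?_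
    · have h1 : MeasurableSet {w : RCPath N | drawdownTime grid a y w.1 n < t} :=
        measurableSet_lt ih measurable_const
      have h2 : MeasurableSet {w : RCPath N | a ≤ grid (runMax y w.1 t) - grid (w.1 t)} :=
        ((measurable_runMax y t).prodMk (RCPath.measurable_coord t))
          (MeasurableSet.of_discrete
            (s := {p : Fin (N + 1) × Fin (N + 1) | a ≤ grid p.1 - grid p.2}))
      have h3 : MeasurableSet {w : RCPath N | runMax y w.1 (drawdownTime grid a y w.1 n).toNNReal ≤
          windowMax w.1 (drawdownTime grid a y w.1 n).toNNReal
            (max (drawdownTime grid a y w.1 n).toNNReal t)} := by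
        refine measurableSet_le ?_ ?_
        · exact IsRightStep.measurable_eval (X := fun s (w : RCPath N) => runMax y w.1 s)
            (measurable_runMax y) (fun w => isRightStep_runMax w.2 y) ih.ennreal_toNNReal
        · exact IsRightStep.measurable_eval
            (X := fun s (w : RCPath N) => windowMax w.1 s (max s t))
            (fun s => measurable_windowMax _ _) (fun w => isRightStep_windowMax_left w.2 t)
            ih.ennreal_toNNReal
      convert h1.inter (h2.inter h3) using 1
      ext w
      simp only [mem_ofPred_eq, mem_inter_iff]
      refine and_congr_right fun h => and_congr_right fun _ => ?_
      have h' : (drawdownTime grid a y w.1 n).toNNReal ≤ t := by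
        simpa using ENNReal.toNNReal_mono ENNReal.coe_ne_top h.le
      rw [max_eq_right h']
    · filter_upwards [w.2 t, isRightStep_runMax w.2 y t,
        isRightStep_windowMax w.2 (drawdownTime grid a y w.1 n).toNNReal t,
        self_mem_nhdsWithin] with s h1 h2 h3 h4
      rw [h1, h2, h3]
      exact ⟨ht.1.trans_le (ENNReal.coe_le_coe.2 h4), ht.2⟩

theorem measurable_drawdownPayoff (grid : Fin (N + 1) → ℝ) (a : ℝ)
    (f : Fin (N + 1) → Fin (N + 1) → ℂ) (n : ℕ) (q : ℂ) (y : Fin (N + 1)) :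
    Measurable fun w : RCPath N => drawdownPayoff grid a f n q y w.1 := by
  have hτ := measurable_drawdownTime grid a y n
  refine Measurable.ite (measurableSet_lt hτ measurable_const) (Measurable.mul ?_ ?_)
    measurable_const
  · exact Complex.measurable_exp.comp
      ((Complex.measurable_ofReal.comp hτ.ennreal_toReal).const_mul q).neg
  · have h1 := RCPath.measurable_eval hτ.ennreal_toNNReal
    have h2 := IsRightStep.measurable_eval (X := fun s (w : RCPath N) => runMax y w.1 s)
            (measurable_runMax y) (fun w => isRightStep_runMax w.2 y) hτ.ennreal_toNNReal
    exact (measurable_of_countable fun p : Fin (N + 1) × Fin (N + 1) => f p.1 p.2).comp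
      (h1.prodMk h2)

theorem measurable_passagePayoff (grid : Fin (N + 1) → ℝ) (S : Set ℝ) (q : ℂ)
    (g : Fin (N + 1) → ℂ) :
    Measurable fun w : RCPath N => passagePayoff grid S (fun _ => q) g w.1 := by
  have hτ := (isOptionalTime_firstPassage grid S).measurable
  simp only [passagePayoff_const]
  refine Measurable.ite (measurableSet_lt hτ measurable_const) (Measurable.mul ?_ ?_)
    measurable_const
  · exact Complex.measurable_exp.comp
      ((Complex.measurable_ofReal.comp hτ.ennreal_toReal).const_mul q).neg
  · exact (measurable_of_countable g).comp (RCPath.measurable_eval hτ.ennreal_toNNReal)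

theorem norm_exp_neg_mul_le_one {q : ℂ} (hq : 0 < q.re) {r : ℝ} (hr : 0 ≤ r) :
    ‖Complex.exp (-(q * (r : ℂ)))‖ ≤ 1 := by
  rw [Complex.norm_exp, Real.exp_le_one_iff]
  simp only [Complex.neg_re, Complex.mul_re, Complex.ofReal_re, Complex.ofReal_im, mul_zero,
    sub_zero, Left.neg_nonpos_iff]
  positivity

theorem norm_drawdownPayoff_le {q : ℂ} (hq : 0 < q.re) (f : Fin (N + 1) → Fin (N + 1) → ℂ)
    (n : ℕ) (y : Fin (N + 1)) (w : ℝ≥0 → Fin (N + 1)) :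
    ‖drawdownPayoff grid a f n q y w‖ ≤ ∑ u, ∑ v, ‖f u v‖ := by
  unfold drawdownPayoff
  split_ifs
  · rw [norm_mul]
    refine (mul_le_of_le_one_left (norm_nonneg _)
      (norm_exp_neg_mul_le_one hq ENNReal.toReal_nonneg)).trans ?_
    set u := w (drawdownTime grid a y w n).toNNReal
    set v := runMax y w (drawdownTime grid a y w n).toNNReal
    calc ‖f u v‖ ≤ ∑ v, ‖f u v‖ :=
          Finset.single_le_sum (f := fun v => ‖f u v‖) (fun _ _ => norm_nonneg _)
            (Finset.mem_univ v)
      _ ≤ _ := Finset.single_le_sum (f := fun u => ∑ v, ‖f u v‖)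
            (fun _ _ => Finset.sum_nonneg fun _ _ => norm_nonneg _) (Finset.mem_univ u)
  · rw [norm_zero]
    positivity

theorem norm_passagePayoff_le {q : ℂ} (hq : 0 < q.re) (S : Set ℝ) (g : Fin (N + 1) → ℂ)
    (w : ℝ≥0 → Fin (N + 1)) :
    ‖passagePayoff grid S (fun _ => q) g w‖ ≤ ∑ u, ‖g u‖ := by
  rw [passagePayoff_const]
  split_ifs
  · rw [norm_mul]
    refine (mul_le_of_le_one_left (norm_nonneg _)
      (norm_exp_neg_mul_le_one hq ENNReal.toReal_nonneg)).trans ?_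
    exact Finset.single_le_sum (f := fun u => ‖g u‖) (fun _ _ => norm_nonneg _)
            (Finset.mem_univ _)
  · rw [norm_zero]
    positivity

/-- If the running maximum of the path after `T`, started from `y'`, continues that of the path,
a renewal of the drawdown times at `T` propagates to all later drawdown times. -/
theorem drawdownTime_add_of_renewal {w : ℝ≥0 → Fin (N + 1)} {T : ℝ≥0} {y y' : Fin (N + 1)}
    {m n : ℕ} (hrun : ∀ s, runMax y w (T + s) = runMax y' (fun u => w (T + u)) s)
    (h : drawdownTime grid a y w n = T + drawdownTime grid a y' (fun u => w (T + u)) m) (k : ℕ) :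
    drawdownTime grid a y w (n + k) =
      T + drawdownTime grid a y' (fun u => w (T + u)) (m + k) := by
  induction k with
  | zero => exact h
  | succ k ih =>
    by_cases ht : drawdownTime grid a y' (fun u => w (T + u)) (m + k) = ⊤
    · rw [ht, add_top] at ih
      rw [← add_assoc, ← add_assoc, drawdownTime_succ_eq_top ht, drawdownTime_succ_eq_top ih,
        add_top]
    · rw [← add_assoc, ← add_assoc, drawdownTime_succ, drawdownTime_succ, ih]
      lift drawdownTime grid a y' (fun u => w (T + u)) (m + k) to ℝ≥0 using ht with τ
      rw [← ENNReal.coe_add, ENNReal.toNNReal_coe, ENNReal.toNNReal_coe]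
      refine iInf_time_shift (fun t ht => ?_) fun s => ?_
      · exact le_self_add.trans (ENNReal.coe_lt_coe.1 ht.1).le
      · rw [hrun, hrun, windowMax_shift, ENNReal.coe_lt_coe, ENNReal.coe_lt_coe,
          add_lt_add_iff_left]

theorem drawdownPayoff_of_renewal {w : ℝ≥0 → Fin (N + 1)} {T : ℝ≥0} {y y' : Fin (N + 1)}
    {m n : ℕ} (hrun : ∀ s, runMax y w (T + s) = runMax y' (fun u => w (T + u)) s)
    (h : drawdownTime grid a y w n = T + drawdownTime grid a y' (fun u => w (T + u)) m)
    (f : Fin (N + 1) → Fin (N + 1) → ℂ) (q : ℂ) :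
    drawdownPayoff grid a f n q y w =
      Complex.exp (-(q * ((T : ℝ) : ℂ))) *
        drawdownPayoff grid a f m q y' (fun u => w (T + u)) := by
  unfold drawdownPayoff
  rw [h]
  by_cases ht : drawdownTime grid a y' (fun u => w (T + u)) m = ⊤
  · simp [ht]
  · lift drawdownTime grid a y' (fun u => w (T + u)) m to ℝ≥0 using ht with τ
    rw [← ENNReal.coe_add, ENNReal.toNNReal_coe, ENNReal.toNNReal_coe, if_pos ENNReal.coe_lt_top,
      if_pos ENNReal.coe_lt_top, hrun, ENNReal.coe_toReal, ENNReal.coe_toReal, ← mul_assoc,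
      ← Complex.exp_add]
    push_cast
    ring_nf

/-- The bounds on `y'` cover both restarts: `y' = w T` after a passage upwards and `y' = y` after
one downwards. -/
theorem runMax_add_of_le {w : ℝ≥0 → Fin (N + 1)} {T : ℝ≥0} {y y' : Fin (N + 1)}
    (hpre : ∀ u < T, w u ≤ y) (h1 : y ≤ y') (h2 : y' ≤ max y (w T)) (s : ℝ≥0) :
    runMax y w (T + s) = runMax y' (fun u => w (T + u)) s := by
  refine eq_of_forall_ge_iff fun c => ?_
  simp only [runMax_le_iff]
  constructor
  · rintro ⟨hy, H⟩
    exact ⟨h2.trans (max_le hy (H T le_self_add)), fun u hu => H _ (by gcongr)⟩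
  · rintro ⟨hy, H⟩
    refine ⟨h1.trans hy, fun u hu => ?_⟩
    rcases lt_or_ge u T with h | h
    · exact (hpre u h).trans (h1.trans hy)
    · obtain ⟨v, rfl⟩ := exists_add_of_le h
      exact H v (le_of_add_le_add_left hu)

/-- If no drawdown is completed before the path gets to a level `w T ≥ y` at time `T`, the first
drawdown time renews at `T`. -/
theorem drawdownTime_one_of_up {w : ℝ≥0 → Fin (N + 1)} {T : ℝ≥0} {y : Fin (N + 1)} (ha : 0 < a)
    (hw : w 0 ≤ y) (hpre : ∀ u < T, w u ≤ y) (hT : y ≤ w T)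
    (hnot : ∀ t < T, ¬ (a ≤ grid (runMax y w t) - grid (w t) ∧ y ≤ windowMax w 0 t)) :
    drawdownTime grid a y w 1 = T + drawdownTime grid a (w T) (fun u => w (T + u)) 1 := by
  have hrun := runMax_add_of_le hpre hT (le_max_right y (w T))
  rw [drawdownTime_succ, drawdownTime_succ]
  simp only [drawdownTime, ENNReal.toNNReal_zero, runMax_zero, add_zero, max_self, max_eq_left hw]
  refine iInf_time_shift (fun t ht => ?_) fun s => ?_
  · by_contra h
    exact hnot t (not_le.1 h) ht.2
  · rw [hrun]
    have h1 : y ≤ windowMax w 0 (T + s) := hT.trans (le_windowMax w zero_le le_self_add)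
    have h2 : w T ≤ windowMax (fun u => w (T + u)) 0 s := by
      simpa using le_windowMax (fun u => w (T + u)) (le_refl 0) (zero_le : 0 ≤ s)
    simp only [h1, h2, and_true]
    constructor
    · rintro ⟨-, h⟩
      refine ⟨?_, h⟩
      -- At the renewal time the path is at its maximum, so the drawdown is `0 < a`; the strict
      -- inequality in the definition of the restarted time therefore costs nothing.
      rw [ENNReal.coe_pos, pos_iff_ne_zero]
      rintro rfl
      rw [runMax_zero, add_zero, max_self, sub_self] at h
      exact ha.not_ge h
    · rintro ⟨h0, h⟩
      exact ⟨h0.trans_le (by gcongr; exact le_add_self), h⟩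

end Drawdown

/-! ### Path decompositions at the first passage time -/

section Pathwise

variable {grid : Fin (N + 1) → ℝ} {a : ℝ}

/-- Below `y` recovery is missing, so nothing is completed before the passage; from then on the
state reached is the running maximum. Only the first drawdown time needs an argument, since renewal
propagates to the later ones. -/
theorem drawdownPayoff_eq_of_Iio (hgrid : StrictMono grid) (ha : 0 < a)
    (f : Fin (N + 1) → Fin (N + 1) → ℂ) {n : ℕ} (hn : 1 ≤ n) (q : ℂ) {y : Fin (N + 1)}
    (w : RCPath N) (hw : w.1 0 ≤ y) :
    drawdownPayoff grid a f n q y w.1 =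
      if firstPassage grid (Iio (grid y)) w.1 < ⊤ then
        Complex.exp (-(q * ((firstPassage grid (Iio (grid y)) w.1).toReal : ℂ))) *
          (if y ≤ w.1 (firstPassage grid (Iio (grid y)) w.1).toNNReal then
            drawdownPayoff grid a f n q (w.1 (firstPassage grid (Iio (grid y)) w.1).toNNReal)
              (w.shift (firstPassage grid (Iio (grid y)) w.1).toNNReal).1
          else 0)
      else 0 := by
  have hpre : ∀ u : ℝ≥0, (u : ℝ≥0∞) < firstPassage grid (Iio (grid y)) w.1 → w.1 u < y :=
    fun u hu => hgrid.lt_iff_lt.1 (mem_of_lt_firstPassage w.2 hu)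
  have hnot : ∀ t : ℝ≥0, (t : ℝ≥0∞) < firstPassage grid (Iio (grid y)) w.1 →
      ¬ y ≤ windowMax w.1 0 t := by
    intro t ht h
    have h0 : ∃ u ≤ t, y ≤ w.1 u := by
      by_contra! H
      -- A supremum bound is available only in non-strict form, so `w u < y` is rewritten as a bound
      -- by the predecessor of `y`.
      have hy : y ≠ 0 := by
        rintro rfl
        exact absurd (H 0 zero_le) (Fin.not_lt_zero _)
      obtain ⟨k, rfl⟩ := Fin.exists_succ_eq.2 hy
      have : windowMax w.1 0 t ≤ k.castSucc :=
        windowMax_le_iff.2 fun u _ hu => Fin.le_castSucc_iff.2 (H u hu)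
      exact absurd (h.trans this) (Fin.castSucc_lt_succ).not_ge
    obtain ⟨u, hu, h1⟩ := h0
    exact absurd (hpre u ((ENNReal.coe_le_coe.2 hu).trans_lt ht)) h1.not_gt
  by_cases hT : firstPassage grid (Iio (grid y)) w.1 = ⊤
  · rw [hT, if_neg (lt_irrefl _), drawdownPayoff, if_neg]
    rw [not_lt, top_le_iff]
    refine drawdownTime_eq_top_of_le hn ?_
    rw [drawdownTime_succ]
    simp only [drawdownTime, ENNReal.toNNReal_zero, runMax_zero, max_eq_left hw, iInf_eq_top]
    rintro t ⟨-, -, h⟩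
    exact absurd h (hnot t (hT ▸ ENNReal.coe_lt_top))
  · obtain ⟨T, hT'⟩ : ∃ T : ℝ≥0, (T : ℝ≥0∞) = _ := ⟨_, ENNReal.coe_toNNReal hT⟩
    rw [← hT'] at hpre hnot ⊢
    simp only [ENNReal.coe_lt_coe] at hpre hnot
    have hyT : y ≤ w.1 T := hgrid.le_iff_le.1 (not_lt.1 (notMem_firstPassage w.2 hT'.symm))
    rw [if_pos ENNReal.coe_lt_top, ENNReal.toNNReal_coe, if_pos hyT, ENNReal.coe_toReal]
    have hrun := runMax_add_of_le (fun u hu => (hpre u hu).le) hyT (le_max_right y (w.1 T))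
    have h1 := drawdownTime_one_of_up (grid := grid) ha hw (fun u hu => (hpre u hu).le) hyT
      fun t ht h => hnot t ht h.2
    have h2 := drawdownTime_add_of_renewal hrun h1 (n - 1)
    rw [Nat.add_sub_cancel' hn] at h2
    exact drawdownPayoff_of_renewal hrun h2 f q

/-- The two ways out of the interval differ. An exit above `y` renews the first drawdown time with a
new maximum. An exit to `y - a` or below completes the first drawdown, recovery being automatic
because the path starts at its maximum. -/
theorem drawdownPayoff_eq_of_Ioc (hgrid : StrictMono grid) (ha : 0 < a)
    (f : Fin (N + 1) → Fin (N + 1) → ℂ) {n : ℕ} (hn : 1 ≤ n) (q : ℂ) {y : Fin (N + 1)}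
    (w : RCPath N) (hw : w.1 0 = y) :
    drawdownPayoff grid a f n q y w.1 =
      if firstPassage grid (Ioc (grid y - a) (grid y)) w.1 < ⊤ then
        Complex.exp (-(q * ((firstPassage grid (Ioc (grid y - a) (grid y)) w.1).toReal : ℂ))) *
          (if y < w.1 (firstPassage grid (Ioc (grid y - a) (grid y)) w.1).toNNReal then
            drawdownPayoff grid a f n q
              (w.1 (firstPassage grid (Ioc (grid y - a) (grid y)) w.1).toNNReal)
              (w.shift (firstPassage grid (Ioc (grid y - a) (grid y)) w.1).toNNReal).1
          else if grid (w.1 (firstPassage grid (Ioc (grid y - a) (grid y)) w.1).toNNReal) ≤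
              grid y - a then
            drawdownPayoff grid a f (n - 1) q y
              (w.shift (firstPassage grid (Ioc (grid y - a) (grid y)) w.1).toNNReal).1
          else 0)
      else 0 := by
  set S := Ioc (grid y - a) (grid y)
  have hpre : ∀ u : ℝ≥0, (u : ℝ≥0∞) < firstPassage grid S w.1 → w.1 u ≤ y :=
    fun u hu => hgrid.le_iff_le.1 (mem_of_lt_firstPassage w.2 hu).2
  have hrunpre : ∀ t : ℝ≥0, (t : ℝ≥0∞) < firstPassage grid S w.1 → runMax y w.1 t = y := by
    intro t ht
    refine le_antisymm (runMax_le_iff.2 ⟨le_rfl, fun u hu => ?_⟩) (le_max_left _ _)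
    exact hpre u ((ENNReal.coe_le_coe.2 hu).trans_lt ht)
  have hnot : ∀ t : ℝ≥0, (t : ℝ≥0∞) < firstPassage grid S w.1 →
      ¬ a ≤ grid (runMax y w.1 t) - grid (w.1 t) := by
    intro t ht h
    rw [hrunpre t ht] at h
    have := (mem_of_lt_firstPassage w.2 ht).1
    linarith
  by_cases hT : firstPassage grid S w.1 = ⊤
  · rw [hT, if_neg (lt_irrefl _), drawdownPayoff, if_neg]
    rw [not_lt, top_le_iff]
    refine drawdownTime_eq_top_of_le hn ?_
    rw [drawdownTime_succ, iInf₂_eq_top]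
    rintro t ⟨-, h, -⟩
    exact absurd h (hnot t (hT ▸ ENNReal.coe_lt_top))
  · obtain ⟨T, hT'⟩ : ∃ T : ℝ≥0, (T : ℝ≥0∞) = _ := ⟨_, ENNReal.coe_toNNReal hT⟩
    have hTS := notMem_firstPassage w.2 hT'.symm
    rw [← hT'] at hpre hnot hrunpre ⊢
    simp only [ENNReal.coe_lt_coe] at hpre hnot hrunpre
    rw [if_pos ENNReal.coe_lt_top, ENNReal.toNNReal_coe, ENNReal.coe_toReal]
    by_cases hyT : y < w.1 T
    · rw [if_pos hyT]
      have hrun := runMax_add_of_le hpre hyT.le (le_max_right y (w.1 T))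
      have h1 := drawdownTime_one_of_up (grid := grid) ha hw.le hpre hyT.le
        fun t ht h => hnot t ht h.1
      have h2 := drawdownTime_add_of_renewal hrun h1 (n - 1)
      rw [Nat.add_sub_cancel' hn] at h2
      exact drawdownPayoff_of_renewal hrun h2 f q
    · have hd : grid (w.1 T) ≤ grid y - a := by
        by_contra h
        exact hTS ⟨not_le.1 h, hgrid.le_iff_le.2 (not_lt.1 hyT)⟩
      rw [if_neg hyT, if_pos hd]
      have hrun := runMax_add_of_le hpre (le_refl y) (le_max_left y (w.1 T))
      -- Needed because the infimum defining `τ_{a,1}` runs over `t > 0`; the start `y` is not below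
      -- `y - a`.
      have hT0 : 0 < T := by
        rw [pos_iff_ne_zero]
        rintro rfl
        rw [hw] at hd
        linarith
      -- The first drawdown time corresponds to the zeroth one of the path after `T`; this is where
      -- the index drops by one.
      have h1 : drawdownTime grid a y w.1 1 =
          T + drawdownTime grid a y (fun u => w.1 (T + u)) 0 := by
        rw [drawdownTime, add_zero, drawdownTime_succ]
        refine le_antisymm (iInf₂_le T ⟨?_, ?_, ?_⟩) (le_iInf₂ fun t ht => ?_)
        · by_contra h
          exact hnot t (ENNReal.coe_lt_coe.1 (not_le.1 h)) ht.2.1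
        · exact ENNReal.coe_pos.2 hT0
        · have h := hrun 0
          rw [add_zero, runMax_zero, add_zero, max_eq_left (not_lt.1 hyT)] at h
          rw [h]
          linarith
        · simp only [drawdownTime, ENNReal.toNNReal_zero, runMax_zero, hw, max_self]
          exact hw.ge.trans (le_windowMax w.1 le_rfl zero_le)
      have h2 := drawdownTime_add_of_renewal hrun h1 (n - 1)
      rw [Nat.add_sub_cancel' hn, zero_add] at h2
      exact drawdownPayoff_of_renewal hrun h2 f q

end Pathwise

/-! ### From path identities to the linear system -/

section Expectations

variable {G : Matrix (Fin (N + 1)) (Fin (N + 1)) ℝ} {μ : Fin (N + 1) → Measure (RCPath N)}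
  {grid : Fin (N + 1) → ℝ}

/-- Decomposition of an expectation at a first passage time. -/
theorem IsChainLaw.integral_firstPassage (hμ : IsChainLaw G μ) (S : Set ℝ) {q : ℂ}
    (hq : 0 < q.re) (x : Fin (N + 1)) {Ψ : RCPath N → ℂ} {F : Fin (N + 1) → RCPath N → ℂ}
    (hF : ∀ z, Measurable (F z)) {C : ℝ} (hC : ∀ z w, ‖F z w‖ ≤ C)
    (hΨ : ∀ᵐ w ∂μ x, Ψ w =
      if firstPassage grid S w.1 < ⊤ then
        Complex.exp (-(q * ((firstPassage grid S w.1).toReal : ℂ))) *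
          F (w.1 (firstPassage grid S w.1).toNNReal)
            (w.shift (firstPassage grid S w.1).toNNReal)
      else 0) :
    ∫ w, Ψ w ∂μ x =
      ∑ z, passage grid μ (fun t w => w.1 t) S (fun _ => q) x (fun u => if u = z then 1 else 0) *
        ∫ w, F z w ∂μ z := by
  classical
  have hpr := hμ.prob
  have hT := isOptionalTime_firstPassage (N := N) grid S
  set T : RCPath N → ℝ≥0∞ := fun w => firstPassage grid S w.1
  have mφ : Measurable fun s : ℝ≥0 => Complex.exp (-(q * ((s : ℝ) : ℂ))) :=
    Complex.measurable_exp.comp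
      ((Complex.measurable_ofReal.comp measurable_coe_nnreal_real).const_mul q).neg
  let B : Fin (N + 1) → Set (RCPath N) := fun z => {w | T w < ⊤ ∧ w.1 (T w).toNNReal = z}
  have mB : ∀ z, MeasurableSet (B z) := hT.measurableSet_eval
  have hp : ∀ z, passage grid μ (fun t w => w.1 t) S (fun _ => q) x
      (fun u => if u = z then 1 else 0) =
      ∫ w in B z, Complex.exp (-(q * (((T w).toNNReal : ℝ) : ℂ))) ∂μ x := by
    intro z
    rw [passage, ← integral_indicator (mB z)]
    congr 1
    ext w
    change passagePayoff grid S (fun _ => q) _ w.1 = _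
    rw [passagePayoff_const]
    by_cases h1 : T w < ⊤
    · by_cases h2 : w.1 (T w).toNNReal = z
      · rw [if_pos h1, if_pos h2, mul_one, indicator_of_mem (show w ∈ B z from ⟨h1, h2⟩)]
        rfl
      · rw [if_pos h1, if_neg h2, mul_zero, indicator_of_notMem fun h => h2 h.2]
    · rw [if_neg h1, indicator_of_notMem fun h => h1 h.1]
  have hint : ∀ z, Integrable ((B z).indicator fun w =>
      Complex.exp (-(q * (((T w).toNNReal : ℝ) : ℂ))) * F z (w.shift (T w).toNNReal)) (μ x) := by
    intro z
    refine Integrable.indicator (Integrable.of_bound (C := C) ?_ (ae_of_all _ fun w => ?_)) (mB z)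
    · exact ((mφ.comp hT.measurable_toNNReal).mul
        ((hF z).comp (RCPath.measurable_shift_random hT.measurable_toNNReal))).aestronglyMeasurable
    · rw [norm_mul]
      exact (mul_le_of_le_one_left (norm_nonneg _)
        (norm_exp_neg_mul_le_one hq NNReal.zero_le_coe)).trans (hC _ _)
  -- If `T` is finite, only the term of the state occupied at `T` survives.
  have hsum : ∀ᵐ w ∂μ x, Ψ w = ∑ z, (B z).indicator (fun w =>
      Complex.exp (-(q * (((T w).toNNReal : ℝ) : ℂ))) * F z (w.shift (T w).toNNReal)) w := by
    filter_upwards [hΨ] with w hw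
    rw [hw]
    by_cases h1 : T w < ⊤
    · rw [if_pos h1, Finset.sum_eq_single_of_mem (w.1 (T w).toNNReal) (Finset.mem_univ _)
        fun z _ hz => indicator_of_notMem (fun h => hz h.2.symm) _,
        indicator_of_mem (show w ∈ B _ from ⟨h1, rfl⟩)]
      rfl
    · rw [if_neg h1]
      exact (Finset.sum_eq_zero fun z _ => indicator_of_notMem (fun h => h1 h.1) _).symm
  rw [integral_congr_ae hsum, integral_finsetSum _ fun z _ => hint z]
  refine Finset.sum_congr rfl fun z _ => ?_
  rw [integral_indicator (mB z), hp]
  exact hμ.setIntegral_strongMarkov hT x z mφ (hF z)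

/-- The case of a continuation functional that is constant on paths: its expectation from `z` is `g
z`. -/
theorem IsChainLaw.passage_eq_sum (hμ : IsChainLaw G μ) (S : Set ℝ) {q : ℂ} (hq : 0 < q.re)
    (x : Fin (N + 1)) (g : Fin (N + 1) → ℂ) :
    passage grid μ (fun t w => w.1 t) S (fun _ => q) x g =
      ∑ z, passage grid μ (fun t w => w.1 t) S (fun _ => q) x (fun u => if u = z then 1 else 0) *
        g z := by
  have hpr := hμ.prob
  have h := hμ.integral_firstPassage (grid := grid) S hq x
    (Ψ := fun w => passagePayoff grid S (fun _ => q) g w.1) (F := fun z _ => g z)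
    (fun z => measurable_const) (C := ∑ z, ‖g z‖)
    (fun z _ => Finset.single_le_sum (f := fun z => ‖g z‖) (fun _ _ => norm_nonneg _)
      (Finset.mem_univ z)) (ae_of_all _ fun w => passagePayoff_const q g w.1)
  simp only [integral_const, probReal_univ, one_smul] at h
  exact h

theorem IsChainLaw.J_eq_of_le (hμ : IsChainLaw G μ) (hgrid : StrictMono grid) {a : ℝ} (ha : 0 < a)
    (f : Fin (N + 1) → Fin (N + 1) → ℂ) {q : ℂ} (hq : 0 < q.re) {n : ℕ} (hn : 1 ≤ n)
    {x y : Fin (N + 1)} (hxy : x ≤ y) :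
    J grid μ (fun t w => w.1 t) a f n q x y =
      ∑ z ∈ Finset.univ.filter (fun z => y ≤ z),
        passage grid μ (fun t w => w.1 t) (Iio (grid y)) (fun _ => q) x
          (fun u => if u = z then 1 else 0) *
        J grid μ (fun t w => w.1 t) a f n q z z := by
  have h := hμ.integral_firstPassage (grid := grid) (Iio (grid y)) hq x
    (Ψ := fun w => drawdownPayoff grid a f n q y w.1)
    (F := fun z w => if y ≤ z then drawdownPayoff grid a f n q z w.1 else 0)
    (fun z => by
      by_cases hz : y ≤ z
      · simpa only [if_pos hz] using measurable_drawdownPayoff grid a f n q z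
      · simpa only [if_neg hz] using measurable_const)
    (C := ∑ u, ∑ v, ‖f u v‖) (fun z w => by
      split_ifs
      · exact norm_drawdownPayoff_le hq f n z w.1
      · rw [norm_zero]; positivity)
    (by
      filter_upwards [hμ.ae_start x] with w hw
      exact drawdownPayoff_eq_of_Iio hgrid ha f hn q w (hw.trans_le hxy))
  refine h.trans ?_
  rw [Finset.sum_filter]
  refine Finset.sum_congr rfl fun z _ => ?_
  by_cases hz : y ≤ z
  · simp only [if_pos hz]; rfl
  · simp only [if_neg hz, integral_zero, mul_zero]

theorem IsChainLaw.J_self_eq (hμ : IsChainLaw G μ) (hgrid : StrictMono grid) {a : ℝ} (ha : 0 < a)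
    (f : Fin (N + 1) → Fin (N + 1) → ℂ) {q : ℂ} (hq : 0 < q.re) {n : ℕ} (hn : 1 ≤ n)
    (y : Fin (N + 1)) :
    J grid μ (fun t w => w.1 t) a f n q y y =
      passage grid μ (fun t w => w.1 t) (Ioc (grid y - a) (grid y)) (fun _ => q) y
        (fun u => J grid μ (fun t w => w.1 t) a f (n - 1) q u y *
          (if grid u ≤ grid y - a then 1 else 0)) +
      ∑ z ∈ Finset.univ.filter (fun z => y < z),
        passage grid μ (fun t w => w.1 t) (Ioc (grid y - a) (grid y)) (fun _ => q) y
          (fun u => if u = z then 1 else 0) *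
        J grid μ (fun t w => w.1 t) a f n q z z := by
  have h := hμ.integral_firstPassage (grid := grid) (Ioc (grid y - a) (grid y)) hq y
    (Ψ := fun w => drawdownPayoff grid a f n q y w.1)
    (F := fun z w => if y < z then drawdownPayoff grid a f n q z w.1
      else if grid z ≤ grid y - a then drawdownPayoff grid a f (n - 1) q y w.1 else 0)
    (fun z => by
      by_cases hz : y < z
      · simpa only [if_pos hz] using measurable_drawdownPayoff grid a f n q z
      · by_cases hz' : grid z ≤ grid y - a
        · simpa only [if_neg hz, if_pos hz'] using measurable_drawdownPayoff grid a f (n - 1) q y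
        · simpa only [if_neg hz, if_neg hz'] using measurable_const)
    (C := ∑ u, ∑ v, ‖f u v‖) (fun z w => by
      split_ifs
      · exact norm_drawdownPayoff_le hq f n z w.1
      · exact norm_drawdownPayoff_le hq f (n - 1) y w.1
      · rw [norm_zero]; positivity)
    (by
      filter_upwards [hμ.ae_start y] with w hw
      exact drawdownPayoff_eq_of_Ioc hgrid ha f hn q w hw)
  refine h.trans ?_
  -- Expanding the downward term over exit states permits a comparison state by state: as `0 < a`,
  -- no state is both above `y` and at most `y - a`, and states in the interval contribute zero.
  rw [hμ.passage_eq_sum _ hq, Finset.sum_filter, ← Finset.sum_add_distrib]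
  refine Finset.sum_congr rfl fun z _ => ?_
  by_cases hz : y < z
  · have hz' : ¬ grid z ≤ grid y - a := by
      have := hgrid hz
      intro h
      linarith
    simp only [if_pos hz, if_neg hz', mul_zero, zero_add]
    rfl
  · by_cases hz' : grid z ≤ grid y - a
    · simp only [if_neg hz, if_pos hz', mul_one, add_zero]
      rfl
    · simp only [if_neg hz, if_neg hz', integral_zero, mul_zero, add_zero]

theorem IsChainLaw.J_zero (hμ : IsChainLaw G μ) (a : ℝ)
    (f : Fin (N + 1) → Fin (N + 1) → ℂ) (q : ℂ) {x y : Fin (N + 1)} (hxy : x ≤ y) :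
    J grid μ (fun t w => w.1 t) a f 0 q x y = f x y := by
  have hpr := hμ.prob
  have h : ∀ᵐ w ∂μ x, drawdownPayoff grid a f 0 q y w.1 = f x y := by
    filter_upwards [hμ.ae_start x] with w hw
    simp [drawdownPayoff, drawdownTime, runMax_zero, hw, hxy]
  exact (integral_congr_ae h).trans (by simp)

end Expectations

/-! ### Transfer from the given chain to its law on path space -/

section Transfer

variable {G : Matrix (Fin (N + 1)) (Fin (N + 1)) ℝ} {Ω : Type*} [MeasurableSpace Ω]
  {P : Fin (N + 1) → Measure Ω} {Y : ℝ≥0 → Ω → Fin (N + 1)}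

/-- The path of the chain as an element of path space. -/
def IsCTMC.path (hY : IsCTMC G P Y) (ω : Ω) : RCPath N :=
  ⟨fun t => Y t ω, isRightStep_of_continuousWithinAt (hY.right_cont ω)⟩

theorem IsCTMC.measurable_path (hY : IsCTMC G P Y) : Measurable hY.path :=
  RCPath.measurable_of_coord hY.meas

theorem IsCTMC.isChainLaw (hY : IsCTMC G P Y) :
    IsChainLaw G fun x => (P x).map hY.path where
  prob x := by
    have := hY.prob x
    exact Measure.isProbabilityMeasure_map hY.measurable_path.aemeasurable
  meas := RCPath.measurable_coord
  right_cont w t := by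
    rw [ContinuousWithinAt, nhds_discrete, tendsto_pure]
    exact w.2 t
  fdd x n t z h0 hm := by
    rw [← hY.fdd x n t z h0 hm, map_measureReal_apply hY.measurable_path]
    · rfl
    · have : {w : RCPath N | ∀ i ≤ n, w.1 (t i) = z i} =
          ⋂ (i : ℕ) (_ : i ≤ n), (fun w : RCPath N => w.1 (t i)) ⁻¹' {z i} := by
        ext w; simp
      rw [this]
      exact .iInter fun i => .iInter fun _ =>
        RCPath.measurable_coord _ (measurableSet_singleton _)

theorem IsCTMC.J_eq (hY : IsCTMC G P Y) (grid : Fin (N + 1) → ℝ) (a : ℝ)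
    (f : Fin (N + 1) → Fin (N + 1) → ℂ) (n : ℕ) (q : ℂ) (x y : Fin (N + 1)) :
    J grid P Y a f n q x y =
      J grid (fun x => (P x).map hY.path) (fun t w => w.1 t) a f n q x y :=
  (integral_map hY.measurable_path.aemeasurable
    (measurable_drawdownPayoff grid a f n q y).aestronglyMeasurable).symm

theorem IsCTMC.passage_eq (hY : IsCTMC G P Y) (grid : Fin (N + 1) → ℝ) (S : Set ℝ) (q : ℂ)
    (x : Fin (N + 1)) (g : Fin (N + 1) → ℂ) :
    passage grid P Y S (fun _ => q) x g =
      passage grid (fun x => (P x).map hY.path) (fun t w => w.1 t) S (fun _ => q) x g :=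
  (integral_map hY.measurable_path.aemeasurable
    (measurable_passagePayoff grid S q g).aestronglyMeasurable).symm

end Transfer

end CTMCDrawdown

theorem mainTheorem6 {N : ℕ} (grid : Fin (N + 1) → ℝ) (hgrid : StrictMono grid)
    (G : Matrix (Fin (N + 1)) (Fin (N + 1)) ℝ) (hG : CTMCDrawdown.IsRateMatrix G)
    {Ω : Type*} [MeasurableSpace Ω] (P : Fin (N + 1) → Measure Ω)
    (Y : ℝ≥0 → Ω → Fin (N + 1)) (hY : CTMCDrawdown.IsCTMC G P Y)
    (a : ℝ) (ha : 0 < a) (f : Fin (N + 1) → Fin (N + 1) → ℂ)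
    (q : ℂ) (hq : 0 < q.re) :
    -- all the expectations involved are expectations of integrable variables
    (∀ (S : Set ℝ) (g : Fin (N + 1) → ℂ) (x : Fin (N + 1)),
      Integrable (fun ω => CTMCDrawdown.passagePayoff grid S (fun _ => q) g (fun t => Y t ω))
        (P x)) ∧
    (∀ (n : ℕ) (x y : Fin (N + 1)), x ≤ y →
      Integrable (fun ω => CTMCDrawdown.drawdownPayoff grid a f n q y (fun t => Y t ω)) (P x)) ∧
    -- the linear system
    (∀ n : ℕ, 1 ≤ n → ∀ x y : Fin (N + 1), x ≤ y →
      CTMCDrawdown.J grid P Y a f n q x y =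
        ∑ z ∈ Finset.univ.filter (fun z => y ≤ z),
          CTMCDrawdown.passage grid P Y (Set.Iio (grid y)) (fun _ => q) x
            (fun u => if u = z then 1 else 0) *
          CTMCDrawdown.J grid P Y a f n q z z) ∧
    (∀ n : ℕ, 1 ≤ n → ∀ y : Fin (N + 1),
      CTMCDrawdown.J grid P Y a f n q y y =
        CTMCDrawdown.passage grid P Y (Set.Ioc (grid y - a) (grid y)) (fun _ => q) y
          (fun u => CTMCDrawdown.J grid P Y a f (n - 1) q u y *
            (if grid u ≤ grid y - a then 1 else 0)) +
        ∑ z ∈ Finset.univ.filter (fun z => y < z),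
          CTMCDrawdown.passage grid P Y (Set.Ioc (grid y - a) (grid y)) (fun _ => q) y
            (fun u => if u = z then 1 else 0) *
          CTMCDrawdown.J grid P Y a f n q z z) ∧
    -- the initial condition
    (∀ x y : Fin (N + 1), x ≤ y → CTMCDrawdown.J grid P Y a f 0 q x y = f x y) := by
  classical
  have hpr := hY.prob
  have hμ := hY.isChainLaw
  refine ⟨fun S g x => ?_, fun n x y _ => ?_, fun n hn x y hxy => ?_, fun n hn y => ?_,
    fun x y hxy => ?_⟩
  · exact Integrable.of_bound
      ((CTMCDrawdown.measurable_passagePayoff grid S q g).comp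
        hY.measurable_path).aestronglyMeasurable _
      (ae_of_all _ fun ω => CTMCDrawdown.norm_passagePayoff_le hq S g _)
  · exact Integrable.of_bound
      ((CTMCDrawdown.measurable_drawdownPayoff grid a f n q y).comp
        hY.measurable_path).aestronglyMeasurable _
      (ae_of_all _ fun ω => CTMCDrawdown.norm_drawdownPayoff_le hq f n y _)
  · simp only [hY.J_eq, hY.passage_eq]
    exact hμ.J_eq_of_le hgrid ha f hq hn hxy
  · simp only [hY.J_eq, hY.passage_eq]
    exact hμ.J_self_eq hgrid ha f hq hn y
  · rw [hY.J_eq]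
    exact hμ.J_zero a f q hxy
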